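/- Let $\ell>0$, $\xi\in(-\ell,\ell)$, $a_+<0<a_-$, and let $a^0$ be the step function equal to $a_-$ on $(-\ell,\xi)$ and to $a_+$ on $(\xi,\ell)$. Let $\varepsilon_0>0$ and let $(a^\varepsilon)_{0<\varepsilon<\varepsilon_0}$ be a family of real Lipschitz functions on $[-\ell,\ell]$ for which there are constants $C_0,C_1>0$, independent of $\varepsilon$, such that for all $\varepsilon\in(0,\varepsilon_0)$ $$|a^\varepsilon|_{L^\infty(-\ell,\ell)}+\varepsilon\left|\frac{da^\varepsilon}{dx}\right|_{L^\infty(-\ell,\ell)}\le C_0,\qquad |a^\varepsilon-a^0|_{L^1(-\ell,\ell)}\le C_1\varepsilon .$$ On the complex space $L^2(-\ell,\ell)$, with domain $H^2(-\ell,\ell)\cap H^1_0(-\ell,\ell)$, consider the operators $$\mathcal L^\varepsilon u=\varepsilon u''-(a^\varepsilon u)',\qquad \mathcal M^\varepsilon v=\varepsilon^2v''-b^\varepsilon v,\qquad b^\varepsilon=\Bigl(\tfrac12a^\varepsilon\Bigr)^2+\tfrac12\,\varepsilon\,\frac{da^\varepsilon}{dx}.$$ Then the following hold. 1. For every $\varepsilon\in(0,\varepsilon_0)$,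 $\mathcal M^\varepsilon$ is self-adjoint and is conjugate to $\varepsilon\mathcal L^\varepsilon$ by the Liouville transform: with $g^\varepsilon(x)=\exp\bigl(-\frac1{2\varepsilon}\int_{-\ell}^x a^\varepsilon(y)\,dy\bigr)$ and $u,f\in L^2(-\ell,\ell)$, one has $u\in D(\mathcal L^\varepsilon)$ and $\mathcal L^\varepsilon u=f$ if and only if $g^\varepsilon u\in D(\mathcal M^\varepsilon)$ and $\mathcal M^\varepsilon(g^\varepsilon u)=\varepsilon g^\varepsilon f$. The spectrum of $\mathcal L^\varepsilon$ consists of eigenvalues, all of them real and negative. 2. There are constants $C,c>0$, independent of $\varepsilon$, such that for every $\varepsilon\in(0,\varepsilon_0)$ the operator $\mathcal L^\varepsilon$ has a first (that is, largest) eigenvalue $\lambda_1^\varepsilon$, and $$-C\,e^{-c/\varepsilon}\le\lambda_1^\varepsilon<0 .$$ -/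

import Mathlib

open MeasureTheory Set
open scoped ENNReal

noncomputable section

namespace DiffusionTransport

/-- Lebesgue measure on the interval `(-ℓ, ℓ)`. -/
abbrev intervalMeasure (ℓ : ℝ) : Measure ℝ := volume.restrict (Ioo (-ℓ) ℓ)

/-- The complex Hilbert space `L²(-ℓ, ℓ)`. -/
abbrev L2 (ℓ : ℝ) : Type := Lp ℂ 2 (intervalMeasure ℓ)

/-- `u` belongs to `H²(-ℓ, ℓ) ∩ H¹₀(-ℓ, ℓ)`, with derivative `u'` and second derivative `u''`:
`u` is differentiable on `[-ℓ, ℓ]`, its derivative `u'` is absolutely continuous, the almost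
everywhere derivative `u''` of `u'` is square integrable, and `u` vanishes at `±ℓ`. -/
structure IsDirichletH2 (ℓ : ℝ) (u u' u'' : ℝ → ℂ) : Prop where
  hasDeriv : ∀ x ∈ Icc (-ℓ) ℓ, HasDerivWithinAt u (u' x) (Icc (-ℓ) ℓ) x
  absCont : AbsolutelyContinuousOnInterval u' (-ℓ) ℓ
  hasSecondDeriv : ∀ᵐ x ∂(intervalMeasure ℓ), HasDerivAt u' (u'' x) x
  memLp : MemLp u'' 2 (intervalMeasure ℓ)
  left : u (-ℓ) = 0
  right : u ℓ = 0

/-- The graph of the operator `𝓛 u = ε u'' - (a u)'` in `L²(-ℓ, ℓ)` with domain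
`H²(-ℓ, ℓ) ∩ H¹₀(-ℓ, ℓ)`: `transportOp ℓ ε a U F` means that `U` is in the domain and
`𝓛 U = F`. -/
def transportOp (ℓ ε : ℝ) (a : ℝ → ℝ) (U F : L2 ℓ) : Prop :=
  ∃ u u' u'' : ℝ → ℂ, IsDirichletH2 ℓ u u' u'' ∧
    U =ᵐ[intervalMeasure ℓ] u ∧
    F =ᵐ[intervalMeasure ℓ] fun x => (ε : ℂ) * u'' x - deriv (fun y => (a y : ℂ) * u y) x

/-- The potential `b = (a / 2)² + (ε / 2) a'`. -/
def potential (ε : ℝ) (a : ℝ → ℝ) (x : ℝ) : ℝ := (a x / 2) ^ 2 + ε / 2 * deriv a x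

/-- The graph of the Schrödinger operator `𝓜 v = ε² v'' - b v` in `L²(-ℓ, ℓ)` with domain
`H²(-ℓ, ℓ) ∩ H¹₀(-ℓ, ℓ)`. -/
def schrodingerOp (ℓ ε : ℝ) (a : ℝ → ℝ) (V G : L2 ℓ) : Prop :=
  ∃ v v' v'' : ℝ → ℂ, IsDirichletH2 ℓ v v' v'' ∧
    V =ᵐ[intervalMeasure ℓ] v ∧
    G =ᵐ[intervalMeasure ℓ] fun x => (ε : ℂ) ^ 2 * v'' x - (potential ε a x : ℂ) * v x

/-- The Liouville factor `exp (-(1 / 2ε) ∫_{-ℓ}^x a)`. -/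
def liouvilleFactor (ℓ ε : ℝ) (a : ℝ → ℝ) (x : ℝ) : ℝ :=
  Real.exp (-(1 / (2 * ε)) * ∫ y in (-ℓ)..x, a y)

/-- The step function equal to `am` to the left of `ξ` and to `ap` to its right. -/
def stepFun (ξ am ap : ℝ) (x : ℝ) : ℝ := if x < ξ then am else ap

section Operators

variable {H : Type*} [NormedAddCommGroup H] [InnerProductSpace ℂ H]

/-- `z` is an eigenvalue of the (unbounded) operator with graph `T`. -/
def IsEigenvalue (T : H → H → Prop) (z : ℂ) : Prop := ∃ U : H, U ≠ 0 ∧ T U (z • U)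

/-- The spectrum of the (unbounded) operator with graph `T`: the complement of the set of `z` for
which `T - z` is a bijection of the domain of `T` onto `H` with a bounded inverse `R`. -/
def opSpectrum (T : H → H → Prop) : Set ℂ :=
  {z | ¬ ∃ R : H →L[ℂ] H, ∀ U F : H, T U (F + z • U) ↔ U = R F}

/-- The (unbounded) operator with graph `T` is densely defined and equal to its adjoint. -/
def IsSelfAdjointOp (T : H → H → Prop) : Prop :=
  Dense {U : H | ∃ F, T U F} ∧
    ∀ V G : H, T V G ↔ ∀ U F : H, T U F → inner ℂ V F = inner ℂ G U

end Operators

end DiffusionTransport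

end

/-!
Let `A` be a primitive of `a`. Integrating `𝓛 u = f` twice, the second time with the integrating
factor `e^{-A/ε}`, inverts `𝓛` by an explicit compact operator, so that the spectrum consists of
eigenvalues. The Liouville transform, multiplication by `e^{-A/2ε}`, conjugates `ε 𝓛` to
`𝓜 = -D* D`, where `D v = ε v' - ½ a v`. Hence `-𝓜⁻¹` is compact and positive, its norm is an
eigenvalue, and `λ₁ = -(ε ‖𝓜⁻¹‖)⁻¹`.

Testing the Rayleigh quotient of `-𝓜` with `e^{A/2ε} χ` gives
`-λ₁ ≤ ε ∫ e^{A/ε} |χ'|² / ∫ e^{A/ε} |χ|²`. By the `L¹` bound, `A(x) - A(ξ)` lies, up to `O(ε)`,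
between two negative multiples of `|x - ξ|`. If `χ = 1` near `ξ`, the points at distance `O(ε)`
from `ξ` make the denominator at least of order `ε e^{A(ξ)/ε}`; since `χ'` vanishes near `ξ`, the
numerator carries an additional factor `e^{-c/ε}`.
-/

noncomputable section

namespace DiffusionTransport

section AbsolutelyContinuous

theorem absolutelyContinuousOnInterval_of_dist_le {X Y : Type*} [PseudoMetricSpace X]
    [PseudoMetricSpace Y] {f : ℝ → X} {g : ℝ → Y} {a b : ℝ}
    (hg : AbsolutelyContinuousOnInterval g a b)
    (h : ∀ x ∈ uIcc a b, ∀ y ∈ uIcc a b, dist (f x) (f y) ≤ dist (g x) (g y)) :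
    AbsolutelyContinuousOnInterval f a b := by
  rw [absolutelyContinuousOnInterval_iff] at hg ⊢
  intro η hη
  obtain ⟨δ, hδ, H⟩ := hg η hη
  refine ⟨δ, hδ, fun I hI hlen => (Finset.sum_le_sum fun i hi => ?_).trans_lt (H I hI hlen)⟩
  exact h _ (hI.1 i hi).1 _ (hI.1 i hi).2

variable {E : Type*} [NormedAddCommGroup E] [NormedSpace ℝ E] {f f' : ℝ → E} {a b c x : ℝ}

theorem absolutelyContinuousOnInterval_intervalIntegral (h : IntervalIntegrable f volume a b)
    (hc : c ∈ uIcc a b) : AbsolutelyContinuousOnInterval (fun x => ∫ t in c..x, f t) a b := by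
  refine absolutelyContinuousOnInterval_of_dist_le
    (h.norm.absolutelyContinuousOnInterval_intervalIntegral hc) fun x hx y hy => ?_
  have hcx := h.mono_set (uIcc_subset_uIcc hc hx)
  have hcy := h.mono_set (uIcc_subset_uIcc hc hy)
  rw [dist_eq_norm, Real.dist_eq, intervalIntegral.integral_interval_sub_left hcx hcy,
    intervalIntegral.integral_interval_sub_left hcx.norm hcy.norm]
  exact intervalIntegral.norm_integral_le_abs_integral_norm

/-- Mathlib's version of this theorem is restricted to real-valued functions. -/
theorem integral_eq_sub_of_absolutelyContinuousOnInterval [CompleteSpace E]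
    (hf : AbsolutelyContinuousOnInterval f a b)
    (hderiv : ∀ᵐ x, x ∈ uIcc a b → HasDerivAt f (f' x) x) (hint : IntervalIntegrable f' volume a b)
    (hx : x ∈ uIcc a b) : ∫ t in a..x, f' t = f x - f a := by
  have hac := hf.fun_sub (absolutelyContinuousOnInterval_intervalIntegral hint left_mem_uIcc)
  obtain ⟨C, hC⟩ := hac.const_of_ae_hasDerivAt_zero (by
    filter_upwards [hderiv, hint.ae_hasDerivAt_integral] with y hy hy' hmem
    simpa using (hy hmem).fun_sub (hy' hmem a left_mem_uIcc))
  have ha := hC a left_mem_uIcc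
  rw [intervalIntegral.integral_same, sub_zero] at ha
  rw [ha, ← hC x hx, sub_sub_cancel]

end AbsolutelyContinuous

section Abstract

variable {H : Type*} [NormedAddCommGroup H] [InnerProductSpace ℂ H] {T T' : H → H → Prop}
  {S : H →L[ℂ] H} {z : ℂ}

/-- The (unbounded) operator with graph `T` is a bijection of its domain onto `H`, with bounded
inverse `S`. -/
structure HasInverse (T : H → H → Prop) (S : H →L[ℂ] H) : Prop where
  graph_iff : ∀ U F, T U F ↔ U = S F
  injective : Function.Injective S

namespace HasInverse

theorem ne_zero_of_mem_opSpectrum (hT : HasInverse T S) (hz : z ∈ opSpectrum T) : z ≠ 0 := by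
  rintro rfl
  exact hz ⟨S, fun U F => by rw [zero_smul, add_zero, hT.graph_iff]⟩

theorem inv_mem_spectrum (hT : HasInverse T S) (hz : z ∈ opSpectrum T) : z⁻¹ ∈ spectrum ℂ S := by
  have hz0 := hT.ne_zero_of_mem_opSpectrum hz
  refine fun hres => hz ?_
  obtain ⟨Q, hQ⟩ := hres
  have Q_apply (U : H) : Q.val U = z⁻¹ • U - S U := by
    rw [hQ, Algebra.algebraMap_eq_smul_one]
    rfl
  refine ⟨z⁻¹ • (Q⁻¹).val ∘L S, fun U F => ?_⟩
  have resolvent_eq : T U (F + z • U) ↔ Q.val (z • U) = S F := by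
    rw [hT.graph_iff, map_add, Q_apply, inv_smul_smul₀ hz0, sub_eq_iff_eq_add]
  rw [resolvent_eq, smul_apply, ContinuousLinearMap.comp_apply, eq_inv_smul_iff₀ hz0]
  refine ⟨fun h => ?_, fun h => ?_⟩
  · rw [← h]
    exact (DFunLike.congr_fun Q.inv_mul (z • U)).symm
  · rw [h]
    exact DFunLike.congr_fun Q.mul_inv (S F)

theorem isEigenvalue_iff (hT : HasInverse T S) :
    IsEigenvalue T z ↔ z ≠ 0 ∧ Module.End.HasEigenvalue (S : Module.End ℂ H) z⁻¹ := by
  constructor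
  · rintro ⟨U, hU, h⟩
    rw [hT.graph_iff, map_smul] at h
    have hz : z ≠ 0 := by rintro rfl; exact hU (by rwa [zero_smul] at h)
    refine ⟨hz, Module.End.hasEigenvalue_of_hasEigenvector
      (x := U) ⟨Module.End.mem_eigenspace_iff.2 ?_, hU⟩⟩
    rwa [eq_comm, inv_smul_eq_iff₀ hz]
  · rintro ⟨hz, hS⟩
    obtain ⟨U, hU⟩ := hS.exists_hasEigenvector
    refine ⟨U, hU.2, (hT.graph_iff _ _).2 ?_⟩
    have hSU : S U = z⁻¹ • U := hU.apply_eq_smul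
    rw [map_smul, hSU, smul_inv_smul₀ hz]

theorem isEigenvalue_of_mem_opSpectrum [CompleteSpace H] (hT : HasInverse T S)
    (hS : IsCompactOperator S) (hz : z ∈ opSpectrum T) : IsEigenvalue T z := by
  have hz0 := hT.ne_zero_of_mem_opSpectrum hz
  exact hT.isEigenvalue_iff.2 ⟨hz0,
    (hS.hasEigenvalue_iff_mem_spectrum (inv_ne_zero hz0)).2 (hT.inv_mem_spectrum hz)⟩

theorem isSelfAdjointOp [CompleteSpace H] (hT : HasInverse T S)
    (hS : LinearMap.IsSymmetric (S : H →ₗ[ℂ] H)) : IsSelfAdjointOp T := by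
  constructor
  · have hdom : {U : H | ∃ F, T U F} = LinearMap.range (S : H →ₗ[ℂ] H) := by
      ext U
      simp [hT.graph_iff, eq_comm]
    rw [hdom, Submodule.dense_iff_topologicalClosure_eq_top,
      Submodule.topologicalClosure_eq_top_iff, hS.orthogonal_range]
    exact LinearMap.ker_eq_bot.2 hT.injective
  · refine fun V G => ⟨fun hVG U F hUF => ?_, fun h => (hT.graph_iff V G).2 ?_⟩
    · rw [(hT.graph_iff V G).1 hVG, (hT.graph_iff U F).1 hUF]
      exact hS G F
    · refine ext_inner_right ℂ fun F => ?_
      rw [h (S F) F ((hT.graph_iff _ _).2 rfl)]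
      exact (hS G F).symm

theorem isPositive_neg (hT : HasInverse T S)
    (hneg : ∀ V G, T V G → ∃ r : ℝ, r ≤ 0 ∧ inner ℂ V G = r) : (-S).IsPositive := by
  refine (ContinuousLinearMap.isPositive_iff_complex _).2 fun G => ?_
  obtain ⟨r, hr, h⟩ := hneg (S G) G ((hT.graph_iff _ _).2 rfl)
  rw [neg_apply, inner_neg_left, h, ← Complex.ofReal_neg]
  exact ⟨congrArg _ (Complex.ofReal_re _), neg_nonneg.2 hr⟩

theorem im_eq_zero_and_re_neg_of_isEigenvalue (hT : HasInverse T S) (hS : (-S).IsPositive)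
    (hz : IsEigenvalue T z) : z.im = 0 ∧ z.re < 0 := by
  have hz0 : z ≠ 0 := (hT.isEigenvalue_iff.1 hz).1
  obtain ⟨U, hU, hTU⟩ := hz
  have hpos : 0 < ‖U‖ ^ 2 := by positivity
  have hform : inner ℂ ((-S) (z • U)) (z • U) = -z * ((‖U‖ ^ 2 : ℝ) : ℂ) := by
    rw [neg_apply, ← (hT.graph_iff _ _).1 hTU, inner_neg_left, inner_smul_right,
      inner_self_eq_norm_sq_to_K, neg_mul, Complex.ofReal_pow]
    rfl
  obtain ⟨hre, him⟩ := Complex.nonneg_iff.1 (hform ▸ hS.inner_nonneg_left (z • U))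
  rw [Complex.re_mul_ofReal, Complex.neg_re, neg_mul, neg_nonneg] at hre
  rw [Complex.im_mul_ofReal, Complex.neg_im, neg_mul, zero_eq_neg] at him
  have him0 : z.im = 0 := (mul_eq_zero.1 him).resolve_right hpos.ne'
  exact ⟨him0, (nonpos_of_mul_nonpos_left hre hpos).lt_of_ne fun h => hz0 (Complex.ext h him0)⟩

theorem norm_inverse_pos [Nontrivial H] (hT : HasInverse T S) : 0 < ‖S‖ := by
  obtain ⟨x, hx⟩ := exists_ne (0 : H)
  refine norm_pos_iff.2 fun h => hx (hT.injective ?_)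
  rw [h, zero_apply, zero_apply]

theorem isGreatest_neg_inv_norm [CompleteSpace H] [Nontrivial H] (hT : HasInverse T S)
    (hcpt : IsCompactOperator S) (hS : (-S).IsPositive) :
    IsGreatest {lam : ℝ | IsEigenvalue T (lam : ℂ)} (-‖S‖⁻¹) := by
  have hpos := hT.norm_inverse_pos
  constructor
  · have hspec : ‖-S‖ ∈ spectrum ℝ (-S) := CStarAlgebra.norm_mem_spectrum_of_nonneg
      ((ContinuousLinearMap.nonneg_iff_isPositive _).2 hS)
    have hspec' : ((-‖S‖ : ℝ) : ℂ) ∈ spectrum ℂ S := by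
      rw [norm_neg] at hspec
      rw [← Set.neg_mem_neg, spectrum.neg_eq, Complex.ofReal_neg, neg_neg]
      exact spectrum.algebraMap_mem ℂ hspec
    have hne : ((-‖S‖ : ℝ) : ℂ) ≠ 0 := Complex.ofReal_ne_zero.2 (neg_ne_zero.2 hpos.ne')
    refine hT.isEigenvalue_iff.2 ⟨?_, ?_⟩
    · exact Complex.ofReal_ne_zero.2 (neg_ne_zero.2 (inv_ne_zero hpos.ne'))
    · rw [← inv_neg, Complex.ofReal_inv, inv_inv]
      exact (hcpt.hasEigenvalue_iff_mem_spectrum hne).2 hspec'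
  · intro lam hlam
    have hneg : lam < 0 := (hT.im_eq_zero_and_re_neg_of_isEigenvalue hS hlam).2
    obtain ⟨U, hU, hTU⟩ := hlam
    have hbound : ‖U‖ ≤ ‖S‖ * (-lam * ‖U‖) := by
      have := S.le_opNorm ((lam : ℂ) • U)
      rwa [← (hT.graph_iff _ _).1 hTU, norm_smul, Complex.norm_real, Real.norm_of_nonpos hneg.le]
        at this
    rw [← mul_assoc, le_mul_iff_one_le_left (norm_pos_iff.2 hU)] at hbound
    rw [le_neg, inv_le_iff_one_le_mul₀' hpos]
    exact hbound

end HasInverse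

theorem norm_sq_apply_le_of_isPositive [CompleteSpace H] {K : H →L[ℂ] H} (hK : K.IsPositive)
    (x : H) : ‖K x‖ ^ 2 ≤ ‖K‖ * (inner ℂ (K x) x).re := by
  obtain ⟨R, rfl⟩ := CStarAlgebra.nonneg_iff_eq_star_mul_self.1
    ((ContinuousLinearMap.nonneg_iff_isPositive K).2 hK)
  calc ‖star R (R x)‖ ^ 2 ≤ (‖star R‖ * ‖R x‖) ^ 2 := by gcongr; exact (star R).le_opNorm _
    _ = ‖star R * R‖ * ‖R x‖ ^ 2 := by rw [CStarRing.norm_star_mul_self, norm_star]; ring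
    _ = ‖star R * R‖ * (inner ℂ ((star R * R) x) x).re :=
      congrArg _ (R.apply_norm_sq_eq_inner_adjoint_left x)

theorem HasInverse.norm_sq_le [CompleteSpace H] (hT : HasInverse T S) (hS : (-S).IsPositive)
    {V G : H} (h : T V G) : ‖V‖ ^ 2 ≤ ‖S‖ * -(inner ℂ V G).re := by
  have := norm_sq_apply_le_of_isPositive hS G
  rwa [neg_apply, norm_neg, norm_neg, inner_neg_left, Complex.neg_re, ← (hT.graph_iff V G).1 h]
    at this

section Conjugation

variable {c : ℂ} {W : H ≃L[ℂ] H}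

theorem HasInverse.of_conj (hT : HasInverse T S) (hc : c ≠ 0)
    (h : ∀ U F, T U F ↔ T' (W U) (c • W F)) :
    HasInverse T' (c⁻¹ • (W : H →L[ℂ] H) ∘L S ∘L (W.symm : H →L[ℂ] H)) where
  graph_iff V G := by
    have hVG := h (W.symm V) (c⁻¹ • W.symm G)
    rw [map_smul, smul_inv_smul₀ hc, W.apply_symm_apply, W.apply_symm_apply] at hVG
    rw [← hVG, hT.graph_iff, map_smul, W.symm_apply_eq, map_smul]
    rfl
  injective := by
    have hcomp : Function.Injective fun G => c⁻¹ • W (S (W.symm G)) :=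
      (smul_right_injective H (inv_ne_zero hc)).comp
        (W.injective.comp (hT.injective.comp W.symm.injective))
    exact hcomp

theorem isEigenvalue_iff_of_conj (h : ∀ U F, T U F ↔ T' (W U) (c • W F)) :
    IsEigenvalue T z ↔ IsEigenvalue T' (c * z) := by
  constructor
  · rintro ⟨U, hU, hT⟩
    refine ⟨W U, W.map_ne_zero_iff.2 hU, ?_⟩
    rwa [h, map_smul, smul_smul] at hT
  · rintro ⟨V, hV, hT⟩
    refine ⟨W.symm V, W.symm.map_ne_zero_iff.2 hV, ?_⟩
    rwa [h, map_smul, smul_smul, W.apply_symm_apply]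

end Conjugation

end Abstract

section IntervalL2

variable {E : Type*} [NormedAddCommGroup E] {ℓ x y : ℝ}

theorem uIcc_neg_self (hℓ : 0 < ℓ) : uIcc (-ℓ) ℓ = Icc (-ℓ) ℓ :=
  uIcc_of_le (neg_le_self hℓ.le)

theorem left_mem (hℓ : 0 < ℓ) : -ℓ ∈ Icc (-ℓ) ℓ := left_mem_Icc.2 (neg_le_self hℓ.le)

theorem right_mem (hℓ : 0 < ℓ) : ℓ ∈ Icc (-ℓ) ℓ := right_mem_Icc.2 (neg_le_self hℓ.le)

theorem ae_mem_Ioo : ∀ᵐ x ∂(intervalMeasure ℓ), x ∈ Ioo (-ℓ) ℓ := ae_restrict_mem measurableSet_Ioo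

theorem intervalMeasure_eq_restrict_Icc : intervalMeasure ℓ = volume.restrict (Icc (-ℓ) ℓ) :=
  restrict_Ioo_eq_restrict_Icc

theorem ae_intervalMeasure_iff {p : ℝ → Prop} :
    (∀ᵐ x ∂(intervalMeasure ℓ), p x) ↔ ∀ᵐ x, x ∈ Icc (-ℓ) ℓ → p x := by
  rw [intervalMeasure_eq_restrict_Icc, ae_restrict_iff' measurableSet_Icc]

theorem intervalIntegrable_of_integrable {f : ℝ → E} (hf : Integrable f (intervalMeasure ℓ))
    (hx : x ∈ Icc (-ℓ) ℓ) (hy : y ∈ Icc (-ℓ) ℓ) : IntervalIntegrable f volume x y := by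
  rw [intervalMeasure_eq_restrict_Icc] at hf
  exact (IntegrableOn.mono_set hf (ordConnected_Icc.uIcc_subset hx hy)).intervalIntegrable

theorem intervalIntegrable_of_memLp {f : ℝ → E} {p : ℝ≥0∞} [Fact (1 ≤ p)]
    (hf : MemLp f p (intervalMeasure ℓ)) (hx : x ∈ Icc (-ℓ) ℓ) (hy : y ∈ Icc (-ℓ) ℓ) :
    IntervalIntegrable f volume x y :=
  intervalIntegrable_of_integrable (hf.integrable Fact.out) hx hy

variable [NormedSpace ℝ E]

theorem intervalIntegral_congr_of_ae {f g : ℝ → E} (h : f =ᵐ[intervalMeasure ℓ] g)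
    (hx : x ∈ Icc (-ℓ) ℓ) (hy : y ∈ Icc (-ℓ) ℓ) : ∫ t in x..y, f t = ∫ t in x..y, g t := by
  rw [intervalMeasure_eq_restrict_Icc] at h
  exact intervalIntegral.integral_congr_ae_restrict (ae_restrict_of_ae_restrict_of_subset
    (uIoc_subset_uIcc.trans (ordConnected_Icc.uIcc_subset hx hy)) h)

theorem intervalIntegral_eq_integral_intervalMeasure (hℓ : 0 < ℓ) (f : ℝ → E) :
    ∫ x in (-ℓ)..ℓ, f x = ∫ x, f x ∂(intervalMeasure ℓ) := by
  rw [intervalIntegral.integral_of_le (neg_le_self hℓ.le), integral_Ioc_eq_integral_Ioo]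

theorem L2.norm_intervalIntegral_le (F : L2 ℓ) (hx : x ∈ Icc (-ℓ) ℓ) (hy : y ∈ Icc (-ℓ) ℓ) :
    ‖∫ t in x..y, F t‖ ≤ √|x - y| * ‖F‖ := by
  wlog hxy : x ≤ y generalizing x y
  · rw [intervalIntegral.integral_symm, norm_neg, abs_sub_comm]
    exact this hy hx (le_of_not_ge hxy)
  have hrestrict : (intervalMeasure ℓ).restrict (Ioo x y) = volume.restrict (Ioo x y) := by
    rw [Measure.restrict_restrict measurableSet_Ioo, inter_eq_left.2 (Ioo_subset_Ioo hx.1 hy.2)]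
  have hlength : (intervalMeasure ℓ).real (Ioo x y) = |x - y| := by
    rw [abs_sub_comm, abs_of_nonneg (sub_nonneg.2 hxy), ← measureReal_restrict_apply_self,
      hrestrict, measureReal_restrict_apply_self, Real.volume_real_Ioo_of_le hxy]
  calc ‖∫ t in x..y, F t‖
      = ‖inner ℂ
          (indicatorConstLp 2 measurableSet_Ioo (measure_ne_top _ (Ioo x y)) (1 : ℂ)) F‖ := by
        rw [L2.inner_indicatorConstLp_one, hrestrict, ← integral_Ioc_eq_integral_Ioo,
          intervalIntegral.integral_of_le hxy]
    _ ≤ _ := norm_inner_le_norm _ _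
    _ = √|x - y| * ‖F‖ := by
        rw [norm_indicatorConstLp two_ne_zero ENNReal.ofNat_ne_top, hlength, norm_one, one_mul,
          ENNReal.toReal_ofNat, ← Real.sqrt_eq_rpow]

theorem continuousOn_primitive {f : ℝ → E} (hℓ : 0 < ℓ) (hf : Integrable f (intervalMeasure ℓ)) :
    ContinuousOn (fun x => ∫ t in (-ℓ)..x, f t) (Icc (-ℓ) ℓ) := by
  rw [intervalMeasure_eq_restrict_Icc, ← uIcc_neg_self hℓ] at hf
  rw [← uIcc_neg_self hℓ]
  exact intervalIntegral.continuousOn_primitive_interval hf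

end IntervalL2

section Volterra

open BoundedContinuousFunction

variable {ℓ : ℝ}

/-- The primitive vanishing at `-ℓ` of an element of `L²(-ℓ, ℓ)`. -/
def primitiveL2 (hℓ : 0 < ℓ) : L2 ℓ →ₗ[ℂ] (Icc (-ℓ) ℓ →ᵇ ℂ) where
  toFun F := mkOfCompact ⟨fun x => ∫ t in (-ℓ)..x, F t, continuousOn_iff_continuous_domRestrict.1
    (continuousOn_primitive hℓ ((Lp.memLp F).integrable one_le_two))⟩
  map_add' F G := by
    ext x
    refine (intervalIntegral_congr_of_ae (Lp.coeFn_add F G) (left_mem hℓ) x.2).trans ?_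
    exact intervalIntegral.integral_add (intervalIntegrable_of_memLp (Lp.memLp F) (left_mem hℓ) x.2)
      (intervalIntegrable_of_memLp (Lp.memLp G) (left_mem hℓ) x.2)
  map_smul' c F := by
    ext x
    refine (intervalIntegral_congr_of_ae (Lp.coeFn_smul c F) (left_mem hℓ) x.2).trans ?_
    exact intervalIntegral.integral_smul c F

theorem isCompactOperator_primitiveL2 (hℓ : 0 < ℓ) : IsCompactOperator (primitiveL2 hℓ) := by
  rw [isCompactOperator_iff_isCompact_closure_image_ball _ one_pos]
  refine arzela_ascoli (Metric.closedBall 0 √(2 * ℓ)) (isCompact_closedBall _ _) _ ?_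
    (Metric.equicontinuous_of_continuity_modulus Real.sqrt ?_ _ ?_)
  · rintro _ x ⟨F, hF, rfl⟩
    rw [mem_ball_zero_iff] at hF
    have hdist : |-ℓ - x| ≤ 2 * ℓ := abs_le.2 ⟨by linarith [x.2.2], by linarith [x.2.1]⟩
    rw [mem_closedBall_zero_iff]
    calc ‖∫ t in (-ℓ)..x, F t‖ ≤ √|-ℓ - x| * ‖F‖ := L2.norm_intervalIntegral_le F (left_mem hℓ) x.2
      _ ≤ √(2 * ℓ) * 1 := by gcongr
      _ = √(2 * ℓ) := mul_one _
  · exact Real.continuous_sqrt.tendsto' 0 0 Real.sqrt_zero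
  · rintro x y ⟨_, F, hF, rfl⟩
    rw [mem_ball_zero_iff] at hF
    calc dist (∫ t in (-ℓ)..x, F t) (∫ t in (-ℓ)..y, F t) = ‖∫ t in y..x, F t‖ := by
          rw [dist_eq_norm, intervalIntegral.integral_interval_sub_left
            (intervalIntegrable_of_memLp (Lp.memLp F) (left_mem hℓ) x.2)
            (intervalIntegrable_of_memLp (Lp.memLp F) (left_mem hℓ) y.2)]
      _ ≤ √|y - x| * ‖F‖ := L2.norm_intervalIntegral_le F y.2 x.2
      _ ≤ √(dist (x : ℝ) y) := by
          rw [Real.dist_eq, abs_sub_comm]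
          exact mul_le_of_le_one_right (Real.sqrt_nonneg _) hF.le

/-- The embedding of the continuous functions on `[-ℓ, ℓ]` into `L²(-ℓ, ℓ)`; they are first extended
to `ℝ` by constants. -/
def continuousToL2 (hℓ : 0 < ℓ) : (Icc (-ℓ) ℓ →ᵇ ℂ) →L[ℂ] L2 ℓ :=
  toLp 2 (intervalMeasure ℓ) ℂ ∘L
    { toFun f := f.compContinuous
        ⟨projIcc (-ℓ) ℓ (neg_le_self hℓ.le), continuous_projIcc⟩
      map_add' _ _ := rfl
      map_smul' _ _ := rfl
      cont := continuous_compContinuous _ }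

/-- The Volterra operator `F ↦ ∫_{-ℓ}^x F` on `L²(-ℓ, ℓ)`. -/
def volterra (hℓ : 0 < ℓ) : L2 ℓ →L[ℂ] L2 ℓ :=
  continuousToL2 hℓ ∘L ContinuousLinearMap.mkOfIsCompactOperator (isCompactOperator_primitiveL2 hℓ)

theorem isCompactOperator_volterra (hℓ : 0 < ℓ) : IsCompactOperator (volterra hℓ) :=
  (isCompactOperator_primitiveL2 hℓ).clm_comp (continuousToL2 hℓ)

theorem volterra_ae (hℓ : 0 < ℓ) (F : L2 ℓ) :
    volterra hℓ F =ᵐ[intervalMeasure ℓ] fun x => ∫ t in (-ℓ)..x, F t := by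
  filter_upwards [coeFn_toLp 2 (intervalMeasure ℓ) ℂ ((primitiveL2 hℓ F).compContinuous
    ⟨projIcc (-ℓ) ℓ (neg_le_self hℓ.le), continuous_projIcc⟩), ae_mem_Ioo] with x hx hmem
  refine hx.trans ?_
  rw [compContinuous_apply, ContinuousMap.coe_mk, projIcc_of_mem _ (Ioo_subset_Icc_self hmem)]
  rfl

end Volterra

section Multiplication

variable {ℓ : ℝ} {m n : ℝ → ℂ}

theorem memLp_of_continuousOn {p : ℝ≥0∞} (hm : ContinuousOn m (Icc (-ℓ) ℓ)) :
    MemLp m p (intervalMeasure ℓ) := by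
  obtain ⟨C, hC⟩ := isCompact_Icc.exists_bound_of_continuousOn hm
  refine MemLp.of_bound ((hm.mono Ioo_subset_Icc_self).aestronglyMeasurable measurableSet_Ioo) C ?_
  filter_upwards [ae_mem_Ioo] with x hx
  exact hC x (Ioo_subset_Icc_self hx)

/-- Multiplication by a bounded function on `L²(-ℓ, ℓ)`. -/
def mulOp (hm : MemLp m ⊤ (intervalMeasure ℓ)) : L2 ℓ →L[ℂ] L2 ℓ :=
  (ContinuousLinearMap.mul ℂ ℂ).holderL (intervalMeasure ℓ) ⊤ 2 2 (hm.toLp m)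

theorem mulOp_ae (hm : MemLp m ⊤ (intervalMeasure ℓ)) (F : L2 ℓ) :
    mulOp hm F =ᵐ[intervalMeasure ℓ] fun x => m x * F x := by
  filter_upwards [(ContinuousLinearMap.mul ℂ ℂ).coeFn_holder (r := 2) (hm.toLp m) F,
    hm.coeFn_toLp] with x hx hmx
  rw [← hmx]
  exact hx

theorem mulOp_mulOp (hm : MemLp m ⊤ (intervalMeasure ℓ)) (hn : MemLp n ⊤ (intervalMeasure ℓ))
    (h : ∀ x, m x * n x = 1) (F : L2 ℓ) : mulOp hm (mulOp hn F) = F := by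
  apply Lp.ext
  filter_upwards [mulOp_ae hm (mulOp hn F), mulOp_ae hn F] with x hmx hnx
  rw [hmx, hnx, ← mul_assoc, h, one_mul]

/-- Multiplication by a bounded function with bounded inverse on `L²(-ℓ, ℓ)`. -/
def mulEquiv (hm : MemLp m ⊤ (intervalMeasure ℓ)) (hn : MemLp n ⊤ (intervalMeasure ℓ))
    (h : ∀ x, m x * n x = 1) : L2 ℓ ≃L[ℂ] L2 ℓ :=
  ContinuousLinearEquiv.equivOfInverse (mulOp hm) (mulOp hn)
    (mulOp_mulOp hn hm fun x => by rw [mul_comm, h]) (mulOp_mulOp hm hn h)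

end Multiplication

section Calculus

variable {ℓ s x : ℝ} {a : ℝ → ℝ}

section Real

variable {E : Type*} [NormedAddCommGroup E] {f f' : ℝ → E}

theorem continuousOn_of_absolutelyContinuousOnInterval (hℓ : 0 < ℓ)
    (hf : AbsolutelyContinuousOnInterval f (-ℓ) ℓ) : ContinuousOn f (Icc (-ℓ) ℓ) := by
  rw [← uIcc_neg_self hℓ]
  exact hf.continuousOn

variable [NormedSpace ℝ E]

theorem absolutelyContinuousOnInterval_of_hasDerivWithinAt (hℓ : 0 < ℓ)
    (hf : ∀ x ∈ Icc (-ℓ) ℓ, HasDerivWithinAt f (f' x) (Icc (-ℓ) ℓ) x)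
    (hf' : ContinuousOn f' (Icc (-ℓ) ℓ)) : AbsolutelyContinuousOnInterval f (-ℓ) ℓ := by
  obtain ⟨C, hC⟩ := isCompact_Icc.exists_bound_of_continuousOn hf'
  refine LipschitzOnWith.absolutelyContinuousOnInterval (K := C.toNNReal) ?_
  rw [uIcc_neg_self hℓ]
  exact (convex_Icc _ _).lipschitzOnWith_of_nnnorm_hasDerivWithin_le hf
    fun x hx => NNReal.le_toNNReal_of_coe_le (hC x hx)

theorem hasDerivWithinAt_primitive [CompleteSpace E] (hℓ : 0 < ℓ)
    (hf : ContinuousOn f (Icc (-ℓ) ℓ)) (hx : x ∈ Icc (-ℓ) ℓ) :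
    HasDerivWithinAt (fun y => ∫ t in (-ℓ)..y, f t) (f x) (Icc (-ℓ) ℓ) x := by
  have : Fact (x ∈ Icc (-ℓ) ℓ) := ⟨hx⟩
  refine intervalIntegral.integral_hasDerivWithinAt_right ?_
    (hf.stronglyMeasurableAtFilter_nhdsWithin measurableSet_Icc x) (hf x hx)
  exact (hf.mono (ordConnected_Icc.uIcc_subset (left_mem hℓ) hx)).intervalIntegrable

theorem ae_hasDerivAt_primitive [CompleteSpace E] (hℓ : 0 < ℓ)
    (hf : Integrable f (intervalMeasure ℓ)) :
    ∀ᵐ x ∂(intervalMeasure ℓ), HasDerivAt (fun y => ∫ t in (-ℓ)..y, f t) (f x) x := by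
  rw [ae_intervalMeasure_iff]
  filter_upwards [(intervalIntegrable_of_integrable hf (left_mem hℓ)
    (right_mem hℓ)).ae_hasDerivAt_integral] with x hx hmem
  rw [← uIcc_neg_self hℓ] at hmem
  exact hx hmem _ left_mem_uIcc

theorem integral_eq_sub_of_ae_hasDerivAt [CompleteSpace E] (hℓ : 0 < ℓ)
    (hf : AbsolutelyContinuousOnInterval f (-ℓ) ℓ)
    (hderiv : ∀ᵐ x ∂(intervalMeasure ℓ), HasDerivAt f (f' x) x)
    (hint : Integrable f' (intervalMeasure ℓ)) (hx : x ∈ Icc (-ℓ) ℓ) :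
    ∫ t in (-ℓ)..x, f' t = f x - f (-ℓ) := by
  rw [ae_intervalMeasure_iff, ← uIcc_neg_self hℓ] at hderiv
  rw [← uIcc_neg_self hℓ] at hx
  exact integral_eq_sub_of_absolutelyContinuousOnInterval hf hderiv
    (intervalIntegrable_of_integrable hint (left_mem hℓ) (right_mem hℓ)) hx

end Real

/-- The function `exp (s ∫_{-ℓ}^x a)`; the Liouville factor is the case `s = -1 / (2ε)`. -/
def expPrimitive (ℓ s : ℝ) (a : ℝ → ℝ) (x : ℝ) : ℝ := Real.exp (s * ∫ y in (-ℓ)..x, a y)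

theorem expPrimitive_pos (ℓ s : ℝ) (a : ℝ → ℝ) (x : ℝ) : 0 < expPrimitive ℓ s a x := Real.exp_pos _

theorem expPrimitive_add (ℓ s t : ℝ) (a : ℝ → ℝ) (x : ℝ) :
    expPrimitive ℓ (s + t) a x = expPrimitive ℓ s a x * expPrimitive ℓ t a x := by
  rw [expPrimitive, add_mul, Real.exp_add, expPrimitive, expPrimitive]

theorem expPrimitive_mul_neg (ℓ s : ℝ) (a : ℝ → ℝ) (x : ℝ) :
    (expPrimitive ℓ s a x : ℂ) * (expPrimitive ℓ (-s) a x : ℂ) = 1 := by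
  rw [← Complex.ofReal_mul, ← expPrimitive_add, add_neg_cancel, expPrimitive, zero_mul,
    Real.exp_zero, Complex.ofReal_one]

theorem hasDerivWithinAt_expPrimitive (hℓ : 0 < ℓ) (s : ℝ) (ha : ContinuousOn a (Icc (-ℓ) ℓ))
    (hx : x ∈ Icc (-ℓ) ℓ) :
    HasDerivWithinAt (fun y => (expPrimitive ℓ s a y : ℂ))
      ((expPrimitive ℓ s a x : ℂ) * ((s : ℂ) * (a x : ℂ))) (Icc (-ℓ) ℓ) x := by
  have h := ((hasDerivWithinAt_primitive hℓ ha hx).const_mul s).exp.ofReal_comp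
  rwa [Complex.ofReal_mul, Complex.ofReal_mul] at h

theorem hasDerivAt_expPrimitive (s : ℝ) (ha : ContinuousOn a (Icc (-ℓ) ℓ)) (hx : x ∈ Ioo (-ℓ) ℓ) :
    HasDerivAt (fun y => (expPrimitive ℓ s a y : ℂ))
      ((expPrimitive ℓ s a x : ℂ) * ((s : ℂ) * (a x : ℂ))) x :=
  (hasDerivWithinAt_expPrimitive (by linarith [hx.1.trans hx.2]) s ha
    (Ioo_subset_Icc_self hx)).hasDerivAt (Icc_mem_nhds hx.1 hx.2)

theorem continuousOn_expPrimitive (hℓ : 0 < ℓ) (s : ℝ) (ha : ContinuousOn a (Icc (-ℓ) ℓ)) :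
    ContinuousOn (fun x => (expPrimitive ℓ s a x : ℂ)) (Icc (-ℓ) ℓ) :=
  fun _ hx => (hasDerivWithinAt_expPrimitive hℓ s ha hx).continuousWithinAt

theorem absolutelyContinuousOnInterval_expPrimitive (hℓ : 0 < ℓ) (s : ℝ)
    (ha : ContinuousOn a (Icc (-ℓ) ℓ)) :
    AbsolutelyContinuousOnInterval (fun x => (expPrimitive ℓ s a x : ℂ)) (-ℓ) ℓ := by
  refine absolutelyContinuousOnInterval_of_hasDerivWithinAt hℓ
    (fun x hx => hasDerivWithinAt_expPrimitive hℓ s ha hx) ?_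
  have := continuousOn_expPrimitive hℓ s ha
  fun_prop

end Calculus

section LipschitzCoefficient

variable {ℓ : ℝ} {K : NNReal} {a : ℝ → ℝ}

theorem absolutelyContinuousOnInterval_ofReal (hℓ : 0 < ℓ) (ha : LipschitzOnWith K a (Icc (-ℓ) ℓ)) :
    AbsolutelyContinuousOnInterval (fun x => (a x : ℂ)) (-ℓ) ℓ := by
  rw [← uIcc_neg_self hℓ] at ha
  exact absolutelyContinuousOnInterval_of_dist_le ha.absolutelyContinuousOnInterval
    fun x _ y _ => (Complex.isometry_ofReal.dist_eq _ _).le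

theorem ae_hasDerivAt_ofReal (ha : LipschitzOnWith K a (Icc (-ℓ) ℓ)) :
    ∀ᵐ x ∂(intervalMeasure ℓ), HasDerivAt (fun y => (a y : ℂ)) ((deriv a x : ℝ) : ℂ) x := by
  have hdiff := ha.ae_differentiableWithinAt_real measurableSet_Icc
  rw [← intervalMeasure_eq_restrict_Icc] at hdiff
  filter_upwards [hdiff, ae_mem_Ioo] with x hx hmem
  exact (hx.differentiableAt (Icc_mem_nhds hmem.1 hmem.2)).hasDerivAt.ofReal_comp

theorem memLp_top_deriv (ha : LipschitzOnWith K a (Icc (-ℓ) ℓ)) :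
    MemLp (fun x => ((deriv a x : ℝ) : ℂ)) ⊤ (intervalMeasure ℓ) := by
  refine MemLp.of_bound (Complex.measurable_ofReal.comp (measurable_deriv a)).aestronglyMeasurable
    K ?_
  filter_upwards [ae_mem_Ioo] with x hx
  rw [Complex.norm_real]
  exact norm_deriv_le_of_lipschitzOn (Icc_mem_nhds hx.1 hx.2) ha

namespace IsDirichletH2

variable {u u' u'' : ℝ → ℂ} {s x : ℝ}

theorem continuousOn (h : IsDirichletH2 ℓ u u' u'') : ContinuousOn u (Icc (-ℓ) ℓ) :=
  fun x hx => (h.hasDeriv x hx).continuousWithinAt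

theorem hasDerivAt (h : IsDirichletH2 ℓ u u' u'') (hx : x ∈ Ioo (-ℓ) ℓ) : HasDerivAt u (u' x) x :=
  (h.hasDeriv x (Ioo_subset_Icc_self hx)).hasDerivAt (Icc_mem_nhds hx.1 hx.2)

theorem absolutelyContinuousOnInterval (hℓ : 0 < ℓ) (h : IsDirichletH2 ℓ u u' u'') :
    AbsolutelyContinuousOnInterval u (-ℓ) ℓ :=
  absolutelyContinuousOnInterval_of_hasDerivWithinAt hℓ h.hasDeriv
    (continuousOn_of_absolutelyContinuousOnInterval hℓ h.absCont)

theorem absolutelyContinuousOnInterval_mul (hℓ : 0 < ℓ) (h : IsDirichletH2 ℓ u u' u'')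
    (ha : LipschitzOnWith K a (Icc (-ℓ) ℓ)) :
    AbsolutelyContinuousOnInterval (fun x => (a x : ℂ) * u x) (-ℓ) ℓ :=
  (absolutelyContinuousOnInterval_ofReal hℓ ha).fun_smul (h.absolutelyContinuousOnInterval hℓ)

theorem ae_hasDerivAt_mul (h : IsDirichletH2 ℓ u u' u'') (ha : LipschitzOnWith K a (Icc (-ℓ) ℓ)) :
    ∀ᵐ x ∂(intervalMeasure ℓ), HasDerivAt (fun y => (a y : ℂ) * u y)
      (((deriv a x : ℝ) : ℂ) * u x + (a x : ℂ) * u' x) x := by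
  filter_upwards [ae_hasDerivAt_ofReal ha, ae_mem_Ioo] with x hx hmem
  exact hx.fun_mul (h.hasDerivAt hmem)

theorem expPrimitive_mul (hℓ : 0 < ℓ) (s : ℝ) (ha : LipschitzOnWith K a (Icc (-ℓ) ℓ))
    (h : IsDirichletH2 ℓ u u' u'') :
    IsDirichletH2 ℓ (fun x => (expPrimitive ℓ s a x : ℂ) * u x)
      (fun x => (expPrimitive ℓ s a x : ℂ) * (u' x + (s : ℂ) * ((a x : ℂ) * u x)))
      (fun x => (expPrimitive ℓ s a x : ℂ) * (u'' x + 2 * (s : ℂ) * ((a x : ℂ) * u' x) +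
        ((s : ℂ) * ((deriv a x : ℝ) : ℂ) + (s : ℂ) ^ 2 * (a x : ℂ) ^ 2) * u x)) where
  hasDeriv x hx := by
    refine ((hasDerivWithinAt_expPrimitive hℓ s ha.continuousOn hx).fun_mul
      (h.hasDeriv x hx)).congr_deriv ?_
    ring
  absCont := (absolutelyContinuousOnInterval_expPrimitive hℓ s ha.continuousOn).fun_smul
    (h.absCont.fun_add ((h.absolutelyContinuousOnInterval_mul hℓ ha).const_smul (s : ℂ)))
  hasSecondDeriv := by
    filter_upwards [h.hasSecondDeriv, h.ae_hasDerivAt_mul ha, ae_mem_Ioo] with x hu' hau hx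
    refine ((hasDerivAt_expPrimitive s ha.continuousOn hx).fun_mul
      (hu'.fun_add (hau.const_mul (s : ℂ)))).congr_deriv ?_
    ring
  memLp := by
    have hE := continuousOn_expPrimitive hℓ s ha.continuousOn
    have ha' := Complex.continuous_ofReal.comp_continuousOn ha.continuousOn
    have hu := h.continuousOn
    have hu' := continuousOn_of_absolutelyContinuousOnInterval hℓ h.absCont
    have hEu'' : MemLp (fun x => (expPrimitive ℓ s a x : ℂ) * u'' x) 2 (intervalMeasure ℓ) :=
      h.memLp.mul (memLp_of_continuousOn (p := ⊤) hE)
    have ha'u : MemLp (fun x => ((deriv a x : ℝ) : ℂ) *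
        ((s : ℂ) * ((expPrimitive ℓ s a x : ℂ) * u x))) 2 (intervalMeasure ℓ) :=
      (memLp_of_continuousOn (p := 2) (by fun_prop)).mul (memLp_top_deriv ha)
    have hrest : MemLp (fun x => (expPrimitive ℓ s a x : ℂ) * (2 * (s : ℂ) * ((a x : ℂ) * u' x) +
        (s : ℂ) ^ 2 * (a x : ℂ) ^ 2 * u x)) 2 (intervalMeasure ℓ) := by
      refine memLp_of_continuousOn ?_
      unfold Function.comp at ha'
      fun_prop
    convert (hEu''.add ha'u).add hrest using 2 with x
    simp only [Pi.add_apply]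
    ring
  left := by rw [h.left, mul_zero]
  right := by rw [h.right, mul_zero]

end IsDirichletH2

end LipschitzCoefficient

section Liouville

variable {ℓ ε : ℝ} {K : NNReal} {a : ℝ → ℝ} {U F V G : L2 ℓ}

theorem transportOp_iff (ha : LipschitzOnWith K a (Icc (-ℓ) ℓ)) :
    transportOp ℓ ε a U F ↔ ∃ u u' u'' : ℝ → ℂ, IsDirichletH2 ℓ u u' u'' ∧
      U =ᵐ[intervalMeasure ℓ] u ∧ F =ᵐ[intervalMeasure ℓ] fun x =>
        (ε : ℂ) * u'' x - (((deriv a x : ℝ) : ℂ) * u x + (a x : ℂ) * u' x) := by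
  refine exists_congr fun u => exists_congr fun u' => exists_congr fun u'' =>
    and_congr_right fun hu => and_congr_right fun _ => ⟨fun h => h.trans ?_, fun h => h.trans ?_⟩
  all_goals
    filter_upwards [hu.ae_hasDerivAt_mul ha] with x hx
    rw [hx.deriv]

theorem schrodingerOp_of_transportOp (hℓ : 0 < ℓ) (hε : 0 < ε)
    (ha : LipschitzOnWith K a (Icc (-ℓ) ℓ))
    (hV : V =ᵐ[intervalMeasure ℓ] fun x => (liouvilleFactor ℓ ε a x : ℂ) * U x)
    (hG : G =ᵐ[intervalMeasure ℓ] fun x => (ε : ℂ) * (liouvilleFactor ℓ ε a x : ℂ) * F x)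
    (h : transportOp ℓ ε a U F) : schrodingerOp ℓ ε a V G := by
  obtain ⟨u, u', u'', hu, hU, hF⟩ := (transportOp_iff ha).1 h
  refine ⟨_, _, _, hu.expPrimitive_mul hℓ (-(1 / (2 * ε))) ha, ?_, ?_⟩
  · filter_upwards [hV, hU] with x hVx hUx
    rw [hVx, hUx]
    rfl
  · have hε' : (ε : ℂ) ≠ 0 := Complex.ofReal_ne_zero.2 hε.ne'
    filter_upwards [hG, hF] with x hGx hFx
    rw [hGx, hFx, potential, liouvilleFactor, ← expPrimitive]
    push_cast
    field_simp
    ring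

theorem transportOp_of_schrodingerOp (hℓ : 0 < ℓ) (hε : 0 < ε)
    (ha : LipschitzOnWith K a (Icc (-ℓ) ℓ))
    (hV : V =ᵐ[intervalMeasure ℓ] fun x => (liouvilleFactor ℓ ε a x : ℂ) * U x)
    (hG : G =ᵐ[intervalMeasure ℓ] fun x => (ε : ℂ) * (liouvilleFactor ℓ ε a x : ℂ) * F x)
    (h : schrodingerOp ℓ ε a V G) : transportOp ℓ ε a U F := by
  obtain ⟨v, v', v'', hv, hVv, hGv⟩ := h
  have hε' : (ε : ℂ) ≠ 0 := Complex.ofReal_ne_zero.2 hε.ne'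
  have hg := expPrimitive_mul_neg ℓ (1 / (2 * ε)) a
  refine (transportOp_iff ha).2 ⟨_, _, _, hv.expPrimitive_mul hℓ (1 / (2 * ε)) ha, ?_, ?_⟩
  · filter_upwards [hV, hVv] with x hVx hvx
    rw [← hvx, hVx, liouvilleFactor, ← expPrimitive, ← mul_assoc, hg, one_mul]
  · filter_upwards [hG, hGv] with x hGx hvx
    have hFx : F x = (expPrimitive ℓ (1 / (2 * ε)) a x : ℂ) * ((ε : ℂ)⁻¹ * G x) := by
      rw [hGx, liouvilleFactor, ← expPrimitive, mul_assoc, inv_mul_cancel_left₀ hε', ← mul_assoc,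
        hg, one_mul]
    rw [hFx, hvx, potential]
    push_cast
    field_simp
    ring

theorem transportOp_iff_schrodingerOp (hℓ : 0 < ℓ) (hε : 0 < ε)
    (ha : LipschitzOnWith K a (Icc (-ℓ) ℓ))
    (hV : V =ᵐ[intervalMeasure ℓ] fun x => (liouvilleFactor ℓ ε a x : ℂ) * U x)
    (hG : G =ᵐ[intervalMeasure ℓ] fun x => (ε : ℂ) * (liouvilleFactor ℓ ε a x : ℂ) * F x) :
    transportOp ℓ ε a U F ↔ schrodingerOp ℓ ε a V G :=
  ⟨schrodingerOp_of_transportOp hℓ hε ha hV hG, transportOp_of_schrodingerOp hℓ hε ha hV hG⟩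

/-- Multiplication by `exp (s ∫_{-ℓ}^x a)` on `L²(-ℓ, ℓ)`. -/
def expMul (hℓ : 0 < ℓ) (s : ℝ) (ha : ContinuousOn a (Icc (-ℓ) ℓ)) : L2 ℓ ≃L[ℂ] L2 ℓ :=
  mulEquiv (memLp_of_continuousOn (continuousOn_expPrimitive hℓ s ha))
    (memLp_of_continuousOn (continuousOn_expPrimitive hℓ (-s) ha)) (expPrimitive_mul_neg ℓ s a)

theorem expMul_ae (hℓ : 0 < ℓ) (s : ℝ) (ha : ContinuousOn a (Icc (-ℓ) ℓ)) (F : L2 ℓ) :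
    expMul hℓ s ha F =ᵐ[intervalMeasure ℓ] fun x => (expPrimitive ℓ s a x : ℂ) * F x :=
  mulOp_ae _ F

theorem transportOp_iff_schrodingerOp_expMul (hℓ : 0 < ℓ) (hε : 0 < ε)
    (ha : LipschitzOnWith K a (Icc (-ℓ) ℓ)) (U F : L2 ℓ) :
    transportOp ℓ ε a U F ↔ schrodingerOp ℓ ε a (expMul hℓ (-(1 / (2 * ε))) ha.continuousOn U)
      ((ε : ℂ) • expMul hℓ (-(1 / (2 * ε))) ha.continuousOn F) := by
  refine transportOp_iff_schrodingerOp hℓ hε ha (expMul_ae hℓ _ _ U) ?_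
  filter_upwards [Lp.coeFn_smul (ε : ℂ) (expMul hℓ (-(1 / (2 * ε))) ha.continuousOn F),
    expMul_ae hℓ (-(1 / (2 * ε))) ha.continuousOn F] with x hsmul hmul
  rw [hsmul, Pi.smul_apply, hmul, smul_eq_mul, mul_assoc]
  rfl

end Liouville

section TransportInverse

variable {ℓ ε : ℝ} {K : NNReal} {a : ℝ → ℝ} {U F : L2 ℓ} {c : ℂ}

/-- The function `ε⁻¹ ∫_{-ℓ}^x e^{-A/ε} (∫_{-ℓ}^y f - c) dy`, where `A` is the primitive of `a`.
Its product with `e^{A/ε}` is the solution of `ε u' - a u = ∫_{-ℓ}^x f - c` vanishing at `-ℓ`. -/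
def reducedSolution (ℓ ε : ℝ) (a : ℝ → ℝ) (f : ℝ → ℂ) (c : ℂ) (x : ℝ) : ℂ :=
  (ε : ℂ)⁻¹ * ∫ y in (-ℓ)..x, (expPrimitive ℓ (-(1 / ε)) a y : ℂ) * ((∫ t in (-ℓ)..y, f t) - c)

theorem continuousOn_primitive_sub (hℓ : 0 < ℓ) (F : L2 ℓ) (c : ℂ) :
    ContinuousOn (fun x => (∫ t in (-ℓ)..x, F t) - c) (Icc (-ℓ) ℓ) :=
  (continuousOn_primitive hℓ ((Lp.memLp F).integrable one_le_two)).sub continuousOn_const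

theorem isDirichletH2_reducedSolution (hℓ : 0 < ℓ) (ha : ContinuousOn a (Icc (-ℓ) ℓ))
    (hend : reducedSolution ℓ ε a F c ℓ = 0) :
    IsDirichletH2 ℓ (reducedSolution ℓ ε a F c)
      (fun x => (ε : ℂ)⁻¹ * ((expPrimitive ℓ (-(1 / ε)) a x : ℂ) * ((∫ t in (-ℓ)..x, F t) - c)))
      (fun x => (ε : ℂ)⁻¹ * ((expPrimitive ℓ (-(1 / ε)) a x : ℂ) *
        (F x - (ε : ℂ)⁻¹ * (a x : ℂ) * ((∫ t in (-ℓ)..x, F t) - c)))) := by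
  have hE := continuousOn_expPrimitive hℓ (-(1 / ε)) ha
  have hQ := continuousOn_primitive_sub hℓ F c
  have hF := (Lp.memLp F).integrable one_le_two
  constructor
  · exact fun x hx => (hasDerivWithinAt_primitive hℓ (hE.mul hQ) hx).const_mul _
  · have hQac := (absolutelyContinuousOnInterval_intervalIntegral (intervalIntegrable_of_integrable
      hF (left_mem hℓ) (right_mem hℓ)) left_mem_uIcc).fun_sub
      (LipschitzWith.const c).lipschitzOnWith.absolutelyContinuousOnInterval
    exact ((absolutelyContinuousOnInterval_expPrimitive hℓ _ ha).fun_smul hQac).const_smul (ε : ℂ)⁻¹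
  · filter_upwards [ae_hasDerivAt_primitive hℓ hF, ae_mem_Ioo] with x hFx hx
    refine (((hasDerivAt_expPrimitive _ ha hx).fun_mul (hFx.sub_const c)).const_mul
      (ε : ℂ)⁻¹).congr_deriv ?_
    push_cast
    ring
  · have ha' := Complex.continuous_ofReal.comp_continuousOn ha
    exact (((Lp.memLp F).sub (memLp_of_continuousOn ((ha'.const_mul (ε : ℂ)⁻¹).mul hQ))).mul
      (memLp_of_continuousOn (p := ⊤) hE)).const_mul (ε : ℂ)⁻¹
  · rw [reducedSolution, intervalIntegral.integral_same, mul_zero]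
  · exact hend

theorem transportOp_of_ae_eq_reducedSolution (hℓ : 0 < ℓ) (hε : 0 < ε)
    (ha : LipschitzOnWith K a (Icc (-ℓ) ℓ)) (hend : reducedSolution ℓ ε a F c ℓ = 0)
    (hU : U =ᵐ[intervalMeasure ℓ] fun x =>
      (expPrimitive ℓ (1 / ε) a x : ℂ) * reducedSolution ℓ ε a F c x) :
    transportOp ℓ ε a U F := by
  refine (transportOp_iff ha).2 ⟨_, _, _, (isDirichletH2_reducedSolution hℓ ha.continuousOn
    hend).expPrimitive_mul hℓ (1 / ε) ha, hU, Filter.Eventually.of_forall fun x => ?_⟩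
  have hε' : (ε : ℂ) ≠ 0 := Complex.ofReal_ne_zero.2 hε.ne'
  calc F x = (expPrimitive ℓ (1 / ε) a x : ℂ) * (expPrimitive ℓ (-(1 / ε)) a x : ℂ) * F x := by
        rw [expPrimitive_mul_neg, one_mul]
    _ = _ := by
        push_cast
        field_simp
        ring

theorem IsDirichletH2.intervalIntegral_deriv {u u' u'' : ℝ → ℂ} (hℓ : 0 < ℓ)
    (hu : IsDirichletH2 ℓ u u' u'') {x : ℝ} (hx : x ∈ Icc (-ℓ) ℓ) :
    ∫ t in (-ℓ)..x, u' t = u x := by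
  have hu' := continuousOn_of_absolutelyContinuousOnInterval hℓ hu.absCont
  rw [integral_eq_sub_of_ae_hasDerivAt hℓ (hu.absolutelyContinuousOnInterval hℓ) ?_
    ((memLp_of_continuousOn (p := 1) hu').integrable le_rfl) hx, hu.left, sub_zero]
  filter_upwards [ae_mem_Ioo] with x hx
  exact hu.hasDerivAt hx

theorem IsDirichletH2.flux_eq {u u' u'' : ℝ → ℂ} (hℓ : 0 < ℓ)
    (ha : LipschitzOnWith K a (Icc (-ℓ) ℓ)) (hu : IsDirichletH2 ℓ u u' u'')
    (hF : F =ᵐ[intervalMeasure ℓ] fun x =>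
      (ε : ℂ) * u'' x - (((deriv a x : ℝ) : ℂ) * u x + (a x : ℂ) * u' x))
    {x : ℝ} (hx : x ∈ Icc (-ℓ) ℓ) :
    (ε : ℂ) * u' x - (a x : ℂ) * u x = (∫ t in (-ℓ)..x, F t) + (ε : ℂ) * u' (-ℓ) := by
  have hderiv : ∀ᵐ x ∂(intervalMeasure ℓ),
      HasDerivAt (fun y => (ε : ℂ) • u' y - (a y : ℂ) * u y) (F x) x := by
    filter_upwards [hu.hasSecondDeriv, hu.ae_hasDerivAt_mul ha, hF] with x hu' hau hFx
    rw [hFx]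
    exact (hu'.const_mul _).fun_sub hau
  rw [integral_eq_sub_of_ae_hasDerivAt hℓ ((hu.absCont.const_smul (ε : ℂ)).fun_sub
    (hu.absolutelyContinuousOnInterval_mul hℓ ha)) hderiv ((Lp.memLp F).integrable one_le_two) hx,
    hu.left, smul_eq_mul, smul_eq_mul]
  ring

theorem exists_ae_eq_reducedSolution (hℓ : 0 < ℓ) (hε : 0 < ε)
    (ha : LipschitzOnWith K a (Icc (-ℓ) ℓ)) (h : transportOp ℓ ε a U F) :
    ∃ c : ℂ, reducedSolution ℓ ε a F c ℓ = 0 ∧ U =ᵐ[intervalMeasure ℓ] fun x =>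
      (expPrimitive ℓ (1 / ε) a x : ℂ) * reducedSolution ℓ ε a F c x := by
  have hε' : (ε : ℂ) ≠ 0 := Complex.ofReal_ne_zero.2 hε.ne'
  obtain ⟨u, u', u'', hu, hU, hF⟩ := (transportOp_iff ha).1 h
  have hsol : ∀ x ∈ Icc (-ℓ) ℓ, (expPrimitive ℓ (-(1 / ε)) a x : ℂ) * u x =
      reducedSolution ℓ ε a F (-((ε : ℂ) * u' (-ℓ))) x := by
    intro x hx
    rw [← (hu.expPrimitive_mul hℓ (-(1 / ε)) ha).intervalIntegral_deriv hℓ hx, reducedSolution,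
      ← intervalIntegral.integral_const_mul]
    refine intervalIntegral.integral_congr fun y hy => ?_
    rw [sub_neg_eq_add, ← hu.flux_eq hℓ ha hF (ordConnected_Icc.uIcc_subset (left_mem hℓ) hx hy)]
    push_cast
    field_simp
    ring
  refine ⟨_, by rw [← hsol ℓ (right_mem hℓ), hu.right, mul_zero], ?_⟩
  filter_upwards [hU, ae_mem_Ioo] with x hUx hx
  rw [hUx, ← hsol x (Ioo_subset_Icc_self hx), ← mul_assoc, expPrimitive_mul_neg, one_mul]

theorem intervalIntegral_expPrimitive_ne_zero (hℓ : 0 < ℓ) (s : ℝ)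
    (ha : ContinuousOn a (Icc (-ℓ) ℓ)) : ∫ x in (-ℓ)..ℓ, (expPrimitive ℓ s a x : ℂ) ≠ 0 := by
  have hcont : ContinuousOn (expPrimitive ℓ s a) (uIcc (-ℓ) ℓ) := uIcc_neg_self hℓ ▸
    (Complex.continuous_re.comp_continuousOn (continuousOn_expPrimitive hℓ s ha) :)
  have hpos := intervalIntegral.intervalIntegral_pos_of_pos hcont.intervalIntegrable
    (fun x => expPrimitive_pos ℓ s a x) (neg_lt_self hℓ)
  rw [intervalIntegral.integral_ofReal]
  exact Complex.ofReal_ne_zero.2 hpos.ne'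

/-- The bounded functional sending `F` to the constant `c` for which `reducedSolution ℓ ε a F c`
vanishes at `ℓ`. -/
def boundaryConst (hℓ : 0 < ℓ) (ε : ℝ) (ha : ContinuousOn a (Icc (-ℓ) ℓ)) : L2 ℓ →L[ℂ] ℂ :=
  (∫ x in (-ℓ)..ℓ, (expPrimitive ℓ (-(1 / ε)) a x : ℂ))⁻¹ •
    innerSL ℂ ((memLp_of_continuousOn (continuousOn_expPrimitive hℓ (-(1 / ε)) ha)).toLp _) ∘L
      volterra hℓ

theorem boundaryConst_apply (hℓ : 0 < ℓ) (ε : ℝ) (ha : ContinuousOn a (Icc (-ℓ) ℓ)) (F : L2 ℓ) :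
    boundaryConst hℓ ε ha F = (∫ x in (-ℓ)..ℓ, (expPrimitive ℓ (-(1 / ε)) a x : ℂ))⁻¹ *
      ∫ x in (-ℓ)..ℓ, (expPrimitive ℓ (-(1 / ε)) a x : ℂ) * ∫ t in (-ℓ)..x, F t := by
  have hE := continuousOn_expPrimitive hℓ (-(1 / ε)) ha
  rw [boundaryConst, smul_apply, smul_eq_mul, ContinuousLinearMap.comp_apply,
    innerSL_apply_apply]
  congr 1
  rw [intervalIntegral_eq_integral_intervalMeasure hℓ]
  refine (L2.inner_def _ _).trans (integral_congr_ae ?_)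
  filter_upwards [(memLp_of_continuousOn (p := 2) hE).coeFn_toLp, volterra_ae hℓ F] with x hEx hVx
  rw [hEx, hVx, RCLike.inner_apply, Complex.conj_ofReal, mul_comm]

theorem reducedSolution_right_eq_zero_iff (hℓ : 0 < ℓ) (hε : 0 < ε)
    (ha : ContinuousOn a (Icc (-ℓ) ℓ)) :
    reducedSolution ℓ ε a F c ℓ = 0 ↔ c = boundaryConst hℓ ε ha F := by
  have hE := continuousOn_expPrimitive hℓ (-(1 / ε)) ha
  have hV := continuousOn_primitive hℓ ((Lp.memLp F).integrable one_le_two)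
  rw [← uIcc_neg_self hℓ] at hE hV
  have hEV : IntervalIntegrable (fun x => (expPrimitive ℓ (-(1 / ε)) a x : ℂ) *
    ∫ t in (-ℓ)..x, F t) volume (-ℓ) ℓ := (hE.mul hV).intervalIntegrable
  have hEc : IntervalIntegrable (fun x => (expPrimitive ℓ (-(1 / ε)) a x : ℂ) * c) volume (-ℓ) ℓ :=
    (hE.mul continuousOn_const).intervalIntegrable
  rw [reducedSolution, mul_eq_zero, inv_eq_zero, Complex.ofReal_eq_zero, or_iff_right hε.ne',
    boundaryConst_apply, eq_inv_mul_iff_mul_eq₀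
      (intervalIntegral_expPrimitive_ne_zero hℓ (-(1 / ε)) ha)]
  simp_rw [mul_sub]
  rw [intervalIntegral.integral_sub hEV hEc, intervalIntegral.integral_mul_const, sub_eq_zero,
    eq_comm]

/-- The inverse of the transport operator: `F` is sent to `e^{A/ε}` times the reduced solution
with the boundary constant of `F`, where `A` is the primitive of `a`. -/
def transportInverse (hℓ : 0 < ℓ) (ε : ℝ) (ha : ContinuousOn a (Icc (-ℓ) ℓ)) : L2 ℓ →L[ℂ] L2 ℓ :=
  (ε : ℂ)⁻¹ • (expMul hℓ (1 / ε) ha : L2 ℓ →L[ℂ] L2 ℓ) ∘L volterra hℓ ∘L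
    (expMul hℓ (-(1 / ε)) ha : L2 ℓ →L[ℂ] L2 ℓ) ∘L
      (volterra hℓ - (boundaryConst hℓ ε ha).smulRight (Lp.const 2 (intervalMeasure ℓ) (1 : ℂ)))

theorem isCompactOperator_transportInverse (hℓ : 0 < ℓ) (ε : ℝ) (ha : ContinuousOn a (Icc (-ℓ) ℓ)) :
    IsCompactOperator (transportInverse hℓ ε ha) :=
  (((isCompactOperator_volterra hℓ).clm_comp (expMul hℓ (1 / ε) ha : L2 ℓ →L[ℂ] L2 ℓ)).comp_clm
    ((expMul hℓ (-(1 / ε)) ha : L2 ℓ →L[ℂ] L2 ℓ) ∘L (volterra hℓ - (boundaryConst hℓ ε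
      ha).smulRight (Lp.const 2 (intervalMeasure ℓ) (1 : ℂ))))).smul (ε : ℂ)⁻¹

theorem transportInverse_ae (hℓ : 0 < ℓ) (ε : ℝ) (ha : ContinuousOn a (Icc (-ℓ) ℓ)) (F : L2 ℓ) :
    transportInverse hℓ ε ha F =ᵐ[intervalMeasure ℓ] fun x =>
      (expPrimitive ℓ (1 / ε) a x : ℂ) * reducedSolution ℓ ε a F (boundaryConst hℓ ε ha F) x := by
  set c := boundaryConst hℓ ε ha F
  set Q : L2 ℓ := volterra hℓ F - c • Lp.const 2 (intervalMeasure ℓ) (1 : ℂ)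
  have hHae : expMul hℓ (-(1 / ε)) ha Q =ᵐ[intervalMeasure ℓ] fun y =>
      (expPrimitive ℓ (-(1 / ε)) a y : ℂ) * ((∫ t in (-ℓ)..y, F t) - c) := by
    filter_upwards [expMul_ae hℓ (-(1 / ε)) ha Q, volterra_ae hℓ F,
      Lp.coeFn_sub (volterra hℓ F) (c • Lp.const 2 (intervalMeasure ℓ) (1 : ℂ)),
      Lp.coeFn_smul c (Lp.const 2 (intervalMeasure ℓ) (1 : ℂ)),
      Lp.coeFn_const 2 (intervalMeasure ℓ) (1 : ℂ)] with x hmul hV hsub hsmul hone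
    rw [hmul, hsub, Pi.sub_apply, hsmul, Pi.smul_apply, hone, hV, Function.const_apply, smul_eq_mul,
      mul_one]
  set H : L2 ℓ := expMul hℓ (-(1 / ε)) ha Q
  change ((ε : ℂ)⁻¹ • expMul hℓ (1 / ε) ha (volterra hℓ H) : L2 ℓ) =ᵐ[intervalMeasure ℓ] _
  filter_upwards [Lp.coeFn_smul (ε : ℂ)⁻¹ (expMul hℓ (1 / ε) ha (volterra hℓ H)),
    expMul_ae hℓ (1 / ε) ha (volterra hℓ H), volterra_ae hℓ H, ae_mem_Ioo] with x hsmul hmul hV hx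
  rw [hsmul, Pi.smul_apply, hmul, hV, smul_eq_mul, reducedSolution, mul_left_comm,
    intervalIntegral_congr_of_ae hHae (left_mem hℓ) (Ioo_subset_Icc_self hx)]

theorem transportOp_iff_eq_transportInverse (hℓ : 0 < ℓ) (hε : 0 < ε)
    (ha : LipschitzOnWith K a (Icc (-ℓ) ℓ)) (U F : L2 ℓ) :
    transportOp ℓ ε a U F ↔ U = transportInverse hℓ ε ha.continuousOn F := by
  constructor
  · intro h
    obtain ⟨c, hc, hU⟩ := exists_ae_eq_reducedSolution hℓ hε ha h
    rw [reducedSolution_right_eq_zero_iff hℓ hε ha.continuousOn] at hc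
    subst hc
    exact Lp.ext (hU.trans (transportInverse_ae hℓ ε ha.continuousOn F).symm)
  · rintro rfl
    exact transportOp_of_ae_eq_reducedSolution hℓ hε ha
      ((reducedSolution_right_eq_zero_iff hℓ hε ha.continuousOn).2 rfl)
      (transportInverse_ae hℓ ε ha.continuousOn F)

theorem IsDirichletH2.ae_eq_zero {u u' u'' : ℝ → ℂ} (hu : IsDirichletH2 ℓ u u' u'')
    (h : u =ᵐ[intervalMeasure ℓ] 0) : ∀ᵐ x ∂(intervalMeasure ℓ), u' x = 0 ∧ u'' x = 0 := by
  have hzero : ∀ {f f' : ℝ → ℂ}, EqOn f 0 (Ioo (-ℓ) ℓ) → ∀ {x : ℝ}, x ∈ Ioo (-ℓ) ℓ →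
      HasDerivAt f (f' x) x → f' x = 0 := fun hf _ hx hderiv =>
    hderiv.unique ((hasDerivAt_const _ (0 : ℂ)).congr_of_eventuallyEq
      (Filter.eventuallyEq_of_mem (Ioo_mem_nhds hx.1 hx.2) hf))
  have hu0 : EqOn u 0 (Ioo (-ℓ) ℓ) := Measure.eqOn_open_of_ae_eq h isOpen_Ioo
    (hu.continuousOn.mono Ioo_subset_Icc_self) continuousOn_const
  have hu'0 : EqOn u' 0 (Ioo (-ℓ) ℓ) := fun x hx => hzero hu0 hx (hu.hasDerivAt hx)
  filter_upwards [hu.hasSecondDeriv, ae_mem_Ioo] with x hx hmem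
  exact ⟨hu'0 hmem, hzero hu'0 hmem hx⟩

theorem hasInverse_transportOp (hℓ : 0 < ℓ) (hε : 0 < ε) (ha : LipschitzOnWith K a (Icc (-ℓ) ℓ)) :
    HasInverse (transportOp ℓ ε a) (transportInverse hℓ ε ha.continuousOn) where
  graph_iff := transportOp_iff_eq_transportInverse hℓ hε ha
  injective := by
    refine (injective_iff_map_eq_zero _).2 fun F hF => ?_
    obtain ⟨u, u', u'', hu, hU, hFu⟩ := (transportOp_iff ha).1
      ((transportOp_iff_eq_transportInverse hℓ hε ha 0 F).2 hF.symm)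
    have hu0 : u =ᵐ[intervalMeasure ℓ] 0 := hU.symm.trans (Lp.coeFn_zero _ _ _)
    refine Lp.eq_zero_iff_ae_eq_zero.2 ?_
    filter_upwards [hFu, hu0, hu.ae_eq_zero hu0] with x hFx hux hx
    rw [hFx, hux, hx.1, hx.2, Pi.zero_apply]
    ring

end TransportInverse

section SchrodingerForm

variable {ℓ ε : ℝ} {K : NNReal} {a : ℝ → ℝ} {v v' v'' : ℝ → ℂ} {V G : L2 ℓ}

/-- The function `D v = ε v' - ½ a v`; the operator `D` factors the Schrödinger operator as
`-D* D`. -/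
def firstOrderFactor (ε : ℝ) (a : ℝ → ℝ) (v v' : ℝ → ℂ) (x : ℝ) : ℂ :=
  (ε : ℂ) * v' x - (1 / 2 : ℂ) * ((a x : ℂ) * v x)

theorem absolutelyContinuousOnInterval_firstOrderFactor (hℓ : 0 < ℓ)
    (ha : LipschitzOnWith K a (Icc (-ℓ) ℓ)) (hv : IsDirichletH2 ℓ v v' v'') :
    AbsolutelyContinuousOnInterval (firstOrderFactor ε a v v') (-ℓ) ℓ :=
  (hv.absCont.const_smul (ε : ℂ)).fun_sub
    ((hv.absolutelyContinuousOnInterval_mul hℓ ha).const_smul (1 / 2 : ℂ))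

theorem ae_hasDerivAt_conj_mul_firstOrderFactor (ha : LipschitzOnWith K a (Icc (-ℓ) ℓ))
    (hv : IsDirichletH2 ℓ v v' v'') (hV : V =ᵐ[intervalMeasure ℓ] v)
    (hG : G =ᵐ[intervalMeasure ℓ] fun x => (ε : ℂ) ^ 2 * v'' x - (potential ε a x : ℂ) * v x) :
    ∀ᵐ x ∂(intervalMeasure ℓ), HasDerivAt
      (fun x => Complex.conjCLE (v x) * ((ε : ℂ) * firstOrderFactor ε a v v' x))
      (((‖firstOrderFactor ε a v v' x‖ ^ 2 : ℝ) : ℂ) + inner ℂ (V x) (G x)) x := by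
  filter_upwards [hv.hasSecondDeriv, hv.ae_hasDerivAt_mul ha, hV, hG, ae_mem_Ioo]
    with x hv' hav hVx hGx hx
  have hconj := Complex.conjCLE.toContinuousLinearMap.hasFDerivAt.comp_hasDerivAt x
    (hv.hasDerivAt hx)
  have hfactor := ((hv'.const_mul (ε : ℂ)).fun_sub (hav.const_mul (1 / 2 : ℂ))).const_mul (ε : ℂ)
  refine (hconj.fun_mul hfactor).congr_deriv ?_
  rw [hVx, hGx, RCLike.inner_apply]
  push_cast
  rw [← Complex.conj_mul' (firstOrderFactor ε a v v' x), potential]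
  simp only [firstOrderFactor, Complex.conjCLE_apply, Function.comp_apply, map_sub, map_mul,
    Complex.conj_ofReal, map_div₀, map_one, map_ofNat]
  push_cast
  ring

theorem inner_eq_neg_integral_firstOrderFactor (hℓ : 0 < ℓ)
    (ha : LipschitzOnWith K a (Icc (-ℓ) ℓ)) (hv : IsDirichletH2 ℓ v v' v'')
    (hV : V =ᵐ[intervalMeasure ℓ] v)
    (hG : G =ᵐ[intervalMeasure ℓ] fun x => (ε : ℂ) ^ 2 * v'' x - (potential ε a x : ℂ) * v x) :
    inner ℂ V G = ((-∫ x in (-ℓ)..ℓ, ‖firstOrderFactor ε a v v' x‖ ^ 2 : ℝ) : ℂ) := by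
  have hfac := absolutelyContinuousOnInterval_firstOrderFactor (ε := ε) hℓ ha hv
  have hfac_int : Integrable (fun x => ((‖firstOrderFactor ε a v v' x‖ ^ 2 : ℝ) : ℂ))
      (intervalMeasure ℓ) :=
    (memLp_of_continuousOn (p := 1) (Complex.continuous_ofReal.comp_continuousOn
      ((continuousOn_of_absolutelyContinuousOnInterval hℓ hfac).norm.pow 2))).integrable le_rfl
  have hinner_int := L2.integrable_inner (𝕜 := ℂ) V G
  have hconj : AbsolutelyContinuousOnInterval (fun x => Complex.conjCLE (v x)) (-ℓ) ℓ :=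
    absolutelyContinuousOnInterval_of_dist_le (hv.absolutelyContinuousOnInterval hℓ)
      fun x _ y _ => (Complex.isometry_conj.dist_eq _ _).le
  have hbdry := integral_eq_sub_of_ae_hasDerivAt hℓ (hconj.fun_smul (hfac.const_smul (ε : ℂ)))
    (ae_hasDerivAt_conj_mul_firstOrderFactor ha hv hV hG) (hfac_int.add hinner_int) (right_mem hℓ)
  rw [intervalIntegral_eq_integral_intervalMeasure hℓ, integral_add hfac_int hinner_int,
    ← intervalIntegral_eq_integral_intervalMeasure hℓ, intervalIntegral.integral_ofReal,
    hv.left, hv.right, map_zero, zero_smul, zero_smul, sub_zero, ← L2.inner_def] at hbdry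
  rw [Complex.ofReal_neg]
  exact eq_neg_of_add_eq_zero_right hbdry

theorem inner_nonpos_of_schrodingerOp (hℓ : 0 < ℓ) (ha : LipschitzOnWith K a (Icc (-ℓ) ℓ))
    (h : schrodingerOp ℓ ε a V G) : ∃ r : ℝ, r ≤ 0 ∧ inner ℂ V G = r := by
  obtain ⟨v, v', v'', hv, hV, hG⟩ := h
  exact ⟨_, neg_nonpos.2 (intervalIntegral.integral_nonneg (neg_le_self hℓ.le) fun x _ =>
    sq_nonneg _), inner_eq_neg_integral_firstOrderFactor hℓ ha hv hV hG⟩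

theorem exists_schrodingerOp (ε : ℝ) (ha : LipschitzOnWith K a (Icc (-ℓ) ℓ))
    (hv : IsDirichletH2 ℓ v v' v'') :
    ∃ V G : L2 ℓ, schrodingerOp ℓ ε a V G ∧ V =ᵐ[intervalMeasure ℓ] v ∧
      G =ᵐ[intervalMeasure ℓ] fun x => (ε : ℂ) ^ 2 * v'' x - (potential ε a x : ℂ) * v x := by
  have hvmem := memLp_of_continuousOn (p := 2) hv.continuousOn
  have hsq : MemLp (fun x => ((a x / 2 : ℝ) : ℂ) ^ 2) ⊤ (intervalMeasure ℓ) :=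
    memLp_of_continuousOn ((Complex.continuous_ofReal.comp_continuousOn
      (ha.continuousOn.div_const 2)).pow 2)
  have hpot : MemLp (fun x => (potential ε a x : ℂ)) ⊤ (intervalMeasure ℓ) := by
    convert hsq.add ((memLp_top_deriv ha).const_mul ((ε / 2 : ℝ) : ℂ)) using 2 with x
    simp only [potential, Pi.add_apply]
    push_cast
    ring
  have hMv := (hv.memLp.const_mul ((ε : ℂ) ^ 2)).sub (hvmem.mul hpot)
  exact ⟨hvmem.toLp v, hMv.toLp _, ⟨v, v', v'', hv, hvmem.coeFn_toLp, hMv.coeFn_toLp⟩,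
    hvmem.coeFn_toLp, hMv.coeFn_toLp⟩

end SchrodingerForm

section SchrodingerInverse

variable {ℓ ε : ℝ} {K : NNReal} {a : ℝ → ℝ}

/-- The inverse of the Schrödinger operator, conjugate to `transportInverse` by the Liouville
transform. -/
def schrodingerInverse (hℓ : 0 < ℓ) (ε : ℝ) (ha : ContinuousOn a (Icc (-ℓ) ℓ)) :
    L2 ℓ →L[ℂ] L2 ℓ :=
  (ε : ℂ)⁻¹ • (expMul hℓ (-(1 / (2 * ε))) ha : L2 ℓ →L[ℂ] L2 ℓ) ∘L transportInverse hℓ ε ha ∘L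
    ((expMul hℓ (-(1 / (2 * ε))) ha).symm : L2 ℓ →L[ℂ] L2 ℓ)

theorem isCompactOperator_schrodingerInverse (hℓ : 0 < ℓ) (ε : ℝ)
    (ha : ContinuousOn a (Icc (-ℓ) ℓ)) : IsCompactOperator (schrodingerInverse hℓ ε ha) :=
  (((isCompactOperator_transportInverse hℓ ε ha).comp_clm
    ((expMul hℓ (-(1 / (2 * ε))) ha).symm : L2 ℓ →L[ℂ] L2 ℓ)).clm_comp
      (expMul hℓ (-(1 / (2 * ε))) ha : L2 ℓ →L[ℂ] L2 ℓ)).smul (ε : ℂ)⁻¹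

theorem hasInverse_schrodingerOp (hℓ : 0 < ℓ) (hε : 0 < ε)
    (ha : LipschitzOnWith K a (Icc (-ℓ) ℓ)) :
    HasInverse (schrodingerOp ℓ ε a) (schrodingerInverse hℓ ε ha.continuousOn) :=
  (hasInverse_transportOp hℓ hε ha).of_conj (Complex.ofReal_ne_zero.2 hε.ne')
    (transportOp_iff_schrodingerOp_expMul hℓ hε ha)

theorem isPositive_neg_schrodingerInverse (hℓ : 0 < ℓ) (hε : 0 < ε)
    (ha : LipschitzOnWith K a (Icc (-ℓ) ℓ)) :
    (-schrodingerInverse hℓ ε ha.continuousOn).IsPositive :=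
  (hasInverse_schrodingerOp hℓ hε ha).isPositive_neg fun _ _ =>
    inner_nonpos_of_schrodingerOp hℓ ha

theorem isSelfAdjointOp_schrodingerOp (hℓ : 0 < ℓ) (hε : 0 < ε)
    (ha : LipschitzOnWith K a (Icc (-ℓ) ℓ)) : IsSelfAdjointOp (schrodingerOp ℓ ε a) := by
  refine (hasInverse_schrodingerOp hℓ hε ha).isSelfAdjointOp fun x y => ?_
  have := (isPositive_neg_schrodingerInverse hℓ hε ha).isSymmetric x y
  simpa using this

theorem isEigenvalue_transportOp_of_mem_opSpectrum (hℓ : 0 < ℓ) (hε : 0 < ε)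
    (ha : LipschitzOnWith K a (Icc (-ℓ) ℓ)) {z : ℂ} (hz : z ∈ opSpectrum (transportOp ℓ ε a)) :
    IsEigenvalue (transportOp ℓ ε a) z :=
  (hasInverse_transportOp hℓ hε ha).isEigenvalue_of_mem_opSpectrum
    (isCompactOperator_transportInverse hℓ ε ha.continuousOn) hz

theorem im_eq_zero_and_re_neg_of_isEigenvalue_transportOp (hℓ : 0 < ℓ) (hε : 0 < ε)
    (ha : LipschitzOnWith K a (Icc (-ℓ) ℓ)) {z : ℂ} (hz : IsEigenvalue (transportOp ℓ ε a) z) :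
    z.im = 0 ∧ z.re < 0 := by
  obtain ⟨him, hre⟩ :=
    (hasInverse_schrodingerOp hℓ hε ha).im_eq_zero_and_re_neg_of_isEigenvalue
      (isPositive_neg_schrodingerInverse hℓ hε ha)
      ((isEigenvalue_iff_of_conj (transportOp_iff_schrodingerOp_expMul hℓ hε ha)).1 hz)
  rw [Complex.re_ofReal_mul] at hre
  rw [Complex.im_ofReal_mul] at him
  exact ⟨(mul_eq_zero.1 him).resolve_left hε.ne', neg_of_mul_neg_right hre hε.le⟩

theorem nontrivial_L2 (hℓ : 0 < ℓ) : Nontrivial (L2 ℓ) := by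
  refine ⟨Lp.const 2 (intervalMeasure ℓ) (1 : ℂ), 0, fun h => ?_⟩
  have hnorm := Lp.norm_const' 2 (intervalMeasure ℓ) (1 : ℂ) two_ne_zero ENNReal.ofNat_ne_top
  rw [h, norm_zero, norm_one, one_mul, measureReal_restrict_apply_univ,
    Real.volume_real_Ioo_of_le (neg_le_self hℓ.le)] at hnorm
  exact (Real.rpow_pos_of_pos (by linarith) _).ne hnorm

theorem isGreatest_eigenvalue_transportOp (hℓ : 0 < ℓ) (hε : 0 < ε)
    (ha : LipschitzOnWith K a (Icc (-ℓ) ℓ)) :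
    IsGreatest {lam : ℝ | IsEigenvalue (transportOp ℓ ε a) (lam : ℂ)}
      (-(ε * ‖schrodingerInverse hℓ ε ha.continuousOn‖)⁻¹) := by
  have := nontrivial_L2 hℓ
  obtain ⟨hmem, hub⟩ := (hasInverse_schrodingerOp hℓ hε ha).isGreatest_neg_inv_norm
    (isCompactOperator_schrodingerInverse hℓ ε ha.continuousOn)
    (isPositive_neg_schrodingerInverse hℓ hε ha)
  have hconj (lam : ℝ) : IsEigenvalue (transportOp ℓ ε a) (lam : ℂ) ↔
      IsEigenvalue (schrodingerOp ℓ ε a) ((ε * lam : ℝ) : ℂ) := by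
    rw [Complex.ofReal_mul]
    exact isEigenvalue_iff_of_conj (transportOp_iff_schrodingerOp_expMul hℓ hε ha)
  rw [mul_inv]
  refine ⟨(hconj _).2 ?_, fun lam hlam => ?_⟩
  · rwa [← mul_neg, mul_inv_cancel_left₀ hε.ne']
  · rw [← mul_neg, ← div_eq_inv_mul, le_div_iff₀' hε]
    exact hub ((hconj lam).1 hlam)

end SchrodingerInverse

section WeightedRayleigh

variable {ℓ ε : ℝ} {K : NNReal} {a : ℝ → ℝ} {u u' u'' : ℝ → ℂ}

theorem norm_sq_eq_integral_norm_sq (hℓ : 0 < ℓ) {V : L2 ℓ} {v : ℝ → ℂ}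
    (hV : V =ᵐ[intervalMeasure ℓ] v) : ‖V‖ ^ 2 = ∫ x in (-ℓ)..ℓ, ‖v x‖ ^ 2 := by
  rw [intervalIntegral_eq_integral_intervalMeasure hℓ]
  apply Complex.ofReal_injective
  rw [← integral_complex_ofReal, Complex.ofReal_pow]
  refine (inner_self_eq_norm_sq_to_K V).symm.trans ((L2.inner_def V V).trans ?_)
  refine integral_congr_ae ?_
  filter_upwards [hV] with x hx
  rw [hx, inner_self_eq_norm_sq_to_K]
  push_cast
  rfl

theorem norm_expPrimitive_mul_sq (ℓ s : ℝ) (a : ℝ → ℝ) (x : ℝ) (z : ℂ) :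
    ‖(expPrimitive ℓ s a x : ℂ) * z‖ ^ 2 = expPrimitive ℓ (2 * s) a x * ‖z‖ ^ 2 := by
  rw [norm_mul, Complex.norm_of_nonneg (expPrimitive_pos ℓ s a x).le, mul_pow, two_mul,
    expPrimitive_add, sq (expPrimitive ℓ s a x)]

theorem firstOrderFactor_expPrimitive_mul (hε : ε ≠ 0) (x : ℝ) :
    firstOrderFactor ε a (fun x => (expPrimitive ℓ (1 / (2 * ε)) a x : ℂ) * u x)
      (fun x => (expPrimitive ℓ (1 / (2 * ε)) a x : ℂ) *
        (u' x + ((1 / (2 * ε) : ℝ) : ℂ) * ((a x : ℂ) * u x))) x =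
      (expPrimitive ℓ (1 / (2 * ε)) a x : ℂ) * ((ε : ℂ) * u' x) := by
  have hε' : (ε : ℂ) ≠ 0 := Complex.ofReal_ne_zero.2 hε
  rw [firstOrderFactor]
  push_cast
  field_simp
  ring

theorem integral_expPrimitive_mul_norm_sq_le (hℓ : 0 < ℓ) (hε : 0 < ε)
    (ha : LipschitzOnWith K a (Icc (-ℓ) ℓ)) (hu : IsDirichletH2 ℓ u u' u'') :
    ∫ x in (-ℓ)..ℓ, expPrimitive ℓ (1 / ε) a x * ‖u x‖ ^ 2 ≤
      ‖schrodingerInverse hℓ ε ha.continuousOn‖ *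
        (ε ^ 2 * ∫ x in (-ℓ)..ℓ, expPrimitive ℓ (1 / ε) a x * ‖u' x‖ ^ 2) := by
  have hdouble : 2 * (1 / (2 * ε)) = 1 / ε := by field_simp
  have hv := hu.expPrimitive_mul hℓ (1 / (2 * ε)) ha
  obtain ⟨V, G, hVG, hV, hG⟩ := exists_schrodingerOp ε ha hv
  have hrayleigh := (hasInverse_schrodingerOp hℓ hε ha).norm_sq_le
    (isPositive_neg_schrodingerInverse hℓ hε ha) hVG
  rw [norm_sq_eq_integral_norm_sq hℓ hV, inner_eq_neg_integral_firstOrderFactor hℓ ha hv hV hG,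
    Complex.ofReal_re, neg_neg] at hrayleigh
  simp_rw [firstOrderFactor_expPrimitive_mul hε.ne', norm_expPrimitive_mul_sq, hdouble, norm_mul,
    Complex.norm_of_nonneg hε.le, mul_pow, mul_left_comm _ (ε ^ 2)] at hrayleigh
  rwa [intervalIntegral.integral_const_mul] at hrayleigh

end WeightedRayleigh

section Concentration

variable {ℓ ξ am ap ε κ r s x y : ℝ} {a : ℝ → ℝ}

theorem expPrimitive_eq_mul_exp (s : ℝ) (ha : ContinuousOn a (Icc (-ℓ) ℓ))
    (hx : x ∈ Icc (-ℓ) ℓ) (hy : y ∈ Icc (-ℓ) ℓ) :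
    expPrimitive ℓ s a y = expPrimitive ℓ s a x * Real.exp (s * ∫ t in x..y, a t) := by
  have hint {z : ℝ} (hz : z ∈ Icc (-ℓ) ℓ) : IntervalIntegrable a volume (-ℓ) z :=
    (ha.mono (ordConnected_Icc.uIcc_subset ⟨le_rfl, hz.1.trans hz.2⟩ hz)).intervalIntegrable
  rw [expPrimitive, expPrimitive, ← Real.exp_add, ← mul_add,
    intervalIntegral.integral_add_adjacent_intervals (hint hx) ((hint hx).symm.trans (hint hy))]

theorem norm_intervalIntegral_le_of_eLpNorm_one_le {f : ℝ → ℝ} (hr : 0 ≤ r)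
    (hf : eLpNorm f 1 (intervalMeasure ℓ) ≤ ENNReal.ofReal r) (hx : x ∈ Icc (-ℓ) ℓ)
    (hy : y ∈ Icc (-ℓ) ℓ) : ‖∫ t in x..y, f t‖ ≤ r := by
  rw [intervalIntegral.norm_intervalIntegral_eq]
  refine (norm_integral_le_lintegral_norm _).trans (ENNReal.toReal_le_of_le_ofReal hr ?_)
  simp_rw [ofReal_norm]
  rw [eLpNorm_one_eq_lintegral_enorm, intervalMeasure_eq_restrict_Icc] at hf
  exact (lintegral_mono_set (uIoc_subset_uIcc.trans
    (ordConnected_Icc.uIcc_subset hx hy))).trans hf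

theorem stepFun_eq_of_mem_uIoo (hy : y ∈ uIoo ξ x) : stepFun ξ am ap y = stepFun ξ am ap x := by
  rcases lt_or_ge x ξ with h | h
  · rw [uIoo_of_ge h.le] at hy
    rw [stepFun, stepFun, if_pos h, if_pos hy.2]
  · rw [uIoo_of_le h] at hy
    rw [stepFun, stepFun, if_neg h.not_gt, if_neg hy.1.not_gt]

theorem sub_mul_stepFun_mem_Icc (ξ am ap x : ℝ) : (x - ξ) * stepFun ξ am ap x ∈
    Icc (-(max am (-ap) * |x - ξ|)) (-(min am (-ap) * |x - ξ|)) := by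
  rcases lt_or_ge x ξ with h | h
  · rw [stepFun, if_pos h, abs_of_neg (sub_neg.2 h)]
    constructor <;> nlinarith [le_max_left am (-ap), min_le_left am (-ap)]
  · rw [stepFun, if_neg h.not_gt, abs_of_nonneg (sub_nonneg.2 h)]
    constructor <;> nlinarith [le_max_right am (-ap), min_le_right am (-ap)]

theorem abs_intervalIntegral_sub_le (ha : ContinuousOn a (Icc (-ℓ) ℓ)) (hr : 0 ≤ r)
    (hL1 : eLpNorm (fun x => a x - stepFun ξ am ap x) 1 (intervalMeasure ℓ) ≤ ENNReal.ofReal r)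
    (hξ : ξ ∈ Icc (-ℓ) ℓ) (hx : x ∈ Icc (-ℓ) ℓ) :
    |(∫ t in ξ..x, a t) - (x - ξ) * stepFun ξ am ap x| ≤ r := by
  have hint : IntervalIntegrable a volume ξ x :=
    (ha.mono (ordConnected_Icc.uIcc_subset hξ hx)).intervalIntegrable
  have hconst : ∫ t in ξ..x, (a t - stepFun ξ am ap t) =
      (∫ t in ξ..x, a t) - (x - ξ) * stepFun ξ am ap x := by
    rw [intervalIntegral.integral_congr_uIoo (g := fun t => a t - stepFun ξ am ap x)
      fun t ht => by rw [stepFun_eq_of_mem_uIoo ht], intervalIntegral.integral_sub hint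
      intervalIntegrable_const, intervalIntegral.integral_const, smul_eq_mul]
  rw [← hconst]
  exact norm_intervalIntegral_le_of_eLpNorm_one_le hr hL1 hξ hx

theorem expPrimitive_mem_Icc (hε : 0 < ε) (ha : ContinuousOn a (Icc (-ℓ) ℓ)) (hκ : 0 ≤ κ)
    (hL1 : eLpNorm (fun x => a x - stepFun ξ am ap x) 1 (intervalMeasure ℓ) ≤
      ENNReal.ofReal (κ * ε)) (hξ : ξ ∈ Icc (-ℓ) ℓ) (hx : x ∈ Icc (-ℓ) ℓ) :
    expPrimitive ℓ (1 / ε) a x ∈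
      Icc (expPrimitive ℓ (1 / ε) a ξ * Real.exp (-κ - max am (-ap) * |x - ξ| / ε))
        (expPrimitive ℓ (1 / ε) a ξ * Real.exp (κ - min am (-ap) * |x - ξ| / ε)) := by
  obtain ⟨hlow, hup⟩ := abs_le.1 (abs_intervalIntegral_sub_le ha (by positivity) hL1 hξ hx)
  obtain ⟨hstep_low, hstep_up⟩ := sub_mul_stepFun_mem_Icc ξ am ap x
  have hpos := expPrimitive_pos ℓ (1 / ε) a ξ
  rw [expPrimitive_eq_mul_exp (1 / ε) ha hξ hx, one_div_mul_eq_div]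
  constructor
  · gcongr
    rw [le_div_iff₀ hε, sub_mul, div_mul_cancel₀ _ hε.ne']
    linarith
  · gcongr
    rw [div_le_iff₀ hε, sub_mul, div_mul_cancel₀ _ hε.ne']
    linarith

end Concentration

section Cutoff

variable {ℓ ξ d : ℝ}

theorem isDirichletH2_of_contDiff {f : ℝ → ℂ} (hℓ : 0 < ℓ) (hf : ContDiff ℝ 2 f)
    (hleft : f (-ℓ) = 0) (hright : f ℓ = 0) :
    IsDirichletH2 ℓ f (deriv f) (deriv (deriv f)) where
  hasDeriv x _ := (hf.differentiable two_ne_zero x).hasDerivAt.hasDerivWithinAt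
  absCont := absolutelyContinuousOnInterval_of_hasDerivWithinAt hℓ
    (fun x _ => (hf.differentiable_deriv_two x).hasDerivAt.hasDerivWithinAt)
    (hf.deriv' (n := 1)).continuous_deriv_one.continuousOn
  hasSecondDeriv := .of_forall fun x => (hf.differentiable_deriv_two x).hasDerivAt
  memLp := memLp_of_continuousOn (hf.deriv' (n := 1)).continuous_deriv_one.continuousOn
  left := hleft
  right := hright

theorem exists_isDirichletH2_cutoff (hd : 0 < d) (hleft : d ≤ ξ + ℓ) (hright : d ≤ ℓ - ξ) :
    ∃ χ χ' χ'' : ℝ → ℂ, IsDirichletH2 ℓ χ χ' χ'' ∧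
      ∀ x ∈ Metric.ball ξ (d / 2), χ x = 1 ∧ χ' x = 0 := by
  let f : ContDiffBump ξ := ⟨d / 2, d, half_pos hd, half_lt_self hd⟩
  have hzero {x : ℝ} (hx : d ≤ |x - ξ|) : (f x : ℂ) = 0 := by
    rw [f.zero_of_le_dist hx, Complex.ofReal_zero]
  have hone : ∀ x ∈ Metric.ball ξ (d / 2), (f x : ℂ) = 1 := fun x hx => by
    rw [f.one_of_mem_closedBall (Metric.ball_subset_closedBall hx), Complex.ofReal_one]
  refine ⟨fun x => (f x : ℂ), _, _, isDirichletH2_of_contDiff (by linarith)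
    (Complex.ofRealCLM.contDiff.comp f.contDiff) (hzero ?_) (hzero ?_), fun x hx =>
    ⟨hone x hx, ?_⟩⟩
  · exact le_abs.2 (.inr (by linarith))
  · exact le_abs.2 (.inl hright)
  · have hconst : (fun x => (f x : ℂ)) =ᶠ[nhds x] fun _ => 1 :=
      Filter.eventuallyEq_of_mem (Metric.isOpen_ball.mem_nhds hx) hone
    rw [hconst.deriv_eq, deriv_const]

end Cutoff

section Gap

variable {ℓ ξ am ap ε κ B δ ρ : ℝ} {K : NNReal} {a : ℝ → ℝ} {χ χ' χ'' : ℝ → ℂ}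

theorem integral_expPrimitive_mul_norm_deriv_sq_le (hε : 0 < ε)
    (ha : ContinuousOn a (Icc (-ℓ) ℓ)) (ham : 0 < am) (hap : ap < 0) (hκ : 0 ≤ κ)
    (hL1 : eLpNorm (fun x => a x - stepFun ξ am ap x) 1 (intervalMeasure ℓ) ≤
      ENNReal.ofReal (κ * ε)) (hξ : ξ ∈ Ioo (-ℓ) ℓ) (hB : ∀ x ∈ Icc (-ℓ) ℓ, ‖χ' x‖ ≤ B)
    (hχ' : ∀ x ∈ Metric.ball ξ δ, χ' x = 0) :
    ∫ x in (-ℓ)..ℓ, expPrimitive ℓ (1 / ε) a x * ‖χ' x‖ ^ 2 ≤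
      2 * ℓ * (expPrimitive ℓ (1 / ε) a ξ * Real.exp (κ - min am (-ap) * δ / ε) * B ^ 2) := by
  have hξ' := Ioo_subset_Icc_self hξ
  have hm : 0 < min am (-ap) := lt_min ham (neg_pos.2 hap)
  have hpos := expPrimitive_pos ℓ (1 / ε) a
  refine (Real.le_norm_self _).trans ((intervalIntegral.norm_integral_le_of_norm_le_const
    (C := expPrimitive ℓ (1 / ε) a ξ * Real.exp (κ - min am (-ap) * δ / ε) * B ^ 2)
    fun x hx => ?_).trans_eq ?_)
  · have hx' : x ∈ Icc (-ℓ) ℓ :=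
      ordConnected_Icc.uIcc_subset ⟨le_rfl, by linarith [hξ.1, hξ.2]⟩
        ⟨by linarith [hξ.1, hξ.2], le_rfl⟩ (uIoc_subset_uIcc hx)
    rw [norm_mul, norm_pow, norm_norm, Real.norm_of_nonneg (hpos x).le]
    by_cases hball : x ∈ Metric.ball ξ δ
    · rw [hχ' x hball, norm_zero, zero_pow two_ne_zero, mul_zero]
      have := hpos ξ
      positivity
    · rw [Metric.mem_ball, Real.dist_eq, not_lt] at hball
      refine mul_le_mul ((expPrimitive_mem_Icc hε ha hκ hL1 hξ' hx').2.trans ?_)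
        (pow_le_pow_left₀ (norm_nonneg _) (hB x hx') 2) (sq_nonneg _)
        (mul_nonneg (hpos ξ).le (Real.exp_pos _).le)
      have := hpos ξ
      gcongr
  · rw [abs_of_pos (by linarith [hξ.1, hξ.2])]
    ring

theorem le_integral_expPrimitive_mul_norm_sq (hε : 0 < ε) (ha : ContinuousOn a (Icc (-ℓ) ℓ))
    (ham : 0 < am) (hκ : 0 ≤ κ)
    (hL1 : eLpNorm (fun x => a x - stepFun ξ am ap x) 1 (intervalMeasure ℓ) ≤
      ENNReal.ofReal (κ * ε)) (hρ : 0 < ρ) (hleft : -ℓ ≤ ξ - ε * ρ) (hright : ξ + ε * ρ ≤ ℓ)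
    (hχc : ContinuousOn χ (Icc (-ℓ) ℓ)) (hχ : ∀ x ∈ Icc (ξ - ε * ρ) (ξ + ε * ρ), χ x = 1) :
    2 * (ε * ρ) * (expPrimitive ℓ (1 / ε) a ξ * Real.exp (-κ - max am (-ap) * ρ)) ≤
      ∫ x in (-ℓ)..ℓ, expPrimitive ℓ (1 / ε) a x * ‖χ x‖ ^ 2 := by
  have hr : 0 < ε * ρ := mul_pos hε hρ
  have hℓ : 0 < ℓ := by linarith
  have hsub : Icc (ξ - ε * ρ) (ξ + ε * ρ) ⊆ Icc (-ℓ) ℓ := Icc_subset_Icc hleft hright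
  have hEc : ContinuousOn (expPrimitive ℓ (1 / ε) a) (Icc (-ℓ) ℓ) :=
    (Complex.continuous_re.comp_continuousOn (continuousOn_expPrimitive hℓ (1 / ε) ha) :)
  have hint : IntervalIntegrable (fun x => expPrimitive ℓ (1 / ε) a x * ‖χ x‖ ^ 2) volume (-ℓ) ℓ :=
    (uIcc_neg_self hℓ ▸ hEc.mul (hχc.norm.pow 2) : ContinuousOn _ (uIcc (-ℓ) ℓ)).intervalIntegrable
  calc 2 * (ε * ρ) * (expPrimitive ℓ (1 / ε) a ξ * Real.exp (-κ - max am (-ap) * ρ))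
      = ∫ _ in (ξ - ε * ρ)..(ξ + ε * ρ),
          expPrimitive ℓ (1 / ε) a ξ * Real.exp (-κ - max am (-ap) * ρ) := by
        rw [intervalIntegral.integral_const, smul_eq_mul]
        ring
    _ ≤ ∫ x in (ξ - ε * ρ)..(ξ + ε * ρ), expPrimitive ℓ (1 / ε) a x * ‖χ x‖ ^ 2 := by
        refine intervalIntegral.integral_mono_on (by linarith) intervalIntegrable_const
          (hint.mono_set ?_) fun x hx => ?_
        · rwa [uIcc_of_le (by linarith), uIcc_neg_self hℓ]
        · rw [hχ x hx, norm_one, one_pow, mul_one]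
          refine le_trans ?_ (expPrimitive_mem_Icc hε ha hκ hL1
            (hsub ⟨by linarith, by linarith⟩) (hsub hx)).1
          have hpos := expPrimitive_pos ℓ (1 / ε) a ξ
          gcongr
          rw [div_le_iff₀ hε, mul_assoc, mul_comm ρ]
          gcongr
          exact abs_sub_le_iff.2 ⟨by linarith [hx.2], by linarith [hx.1]⟩
    _ ≤ ∫ x in (-ℓ)..ℓ, expPrimitive ℓ (1 / ε) a x * ‖χ x‖ ^ 2 :=
        intervalIntegral.integral_mono_interval hleft (by linarith) hright
          (.of_forall fun x => mul_nonneg (expPrimitive_pos ℓ _ a x).le (sq_nonneg _)) hint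

theorem inv_mul_norm_schrodingerInverse_le (hℓ : 0 < ℓ) (hε : 0 < ε)
    (ha : LipschitzOnWith K a (Icc (-ℓ) ℓ)) (ham : 0 < am) (hap : ap < 0) (hκ : 0 ≤ κ)
    (hL1 : eLpNorm (fun x => a x - stepFun ξ am ap x) 1 (intervalMeasure ℓ) ≤
      ENNReal.ofReal (κ * ε)) (hleft : -ℓ ≤ ξ - δ) (hright : ξ + δ ≤ ℓ)
    (hρ : 0 < ρ) (hρδ : ε * ρ < δ) (hχ : IsDirichletH2 ℓ χ χ' χ'')
    (hB : ∀ x ∈ Icc (-ℓ) ℓ, ‖χ' x‖ ≤ B) (hχξ : ∀ x ∈ Metric.ball ξ δ, χ x = 1 ∧ χ' x = 0) :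
    (ε * ‖schrodingerInverse hℓ ε ha.continuousOn‖)⁻¹ ≤
      ℓ * B ^ 2 / ρ * Real.exp (2 * κ + max am (-ap) * ρ) *
        Real.exp (-(min am (-ap) * δ) / ε) := by
  have hr : 0 < ε * ρ := mul_pos hε hρ
  set S := ‖schrodingerInverse hℓ ε ha.continuousOn‖
  set E := expPrimitive ℓ (1 / ε) a ξ
  have hE : 0 < E := expPrimitive_pos ℓ (1 / ε) a ξ
  have hS : 0 < S := by
    have := nontrivial_L2 hℓ
    exact (hasInverse_schrodingerOp hℓ hε ha).norm_inverse_pos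
  have hlow := le_integral_expPrimitive_mul_norm_sq (ap := ap) hε ha.continuousOn ham hκ hL1 hρ
    (by linarith) (by linarith) hχ.continuousOn fun x hx => (hχξ x (by
      rw [Metric.mem_ball, Real.dist_eq, abs_sub_lt_iff]
      constructor <;> linarith [hx.1, hx.2])).1
  have hup := integral_expPrimitive_mul_norm_deriv_sq_le hε ha.continuousOn ham hap hκ hL1
    ⟨by linarith, by linarith⟩ hB fun x hx => (hχξ x hx).2
  have hquot : 2 * (ε * ρ) * (E * Real.exp (-κ - max am (-ap) * ρ)) ≤
      S * (ε ^ 2 * (2 * ℓ * (E * Real.exp (κ - min am (-ap) * δ / ε) * B ^ 2))) :=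
    (hlow.trans (integral_expPrimitive_mul_norm_sq_le hℓ hε ha hχ)).trans (by gcongr)
  have hcancel : ρ * Real.exp (-κ - max am (-ap) * ρ) ≤
      ε * S * (ℓ * B ^ 2 * Real.exp (κ - min am (-ap) * δ / ε)) := by
    refine le_of_mul_le_mul_left ?_ (show 0 < 2 * ε * E by positivity)
    linarith
  rw [inv_le_iff_one_le_mul₀ (mul_pos hε hS)]
  calc (1 : ℝ) = ρ⁻¹ * Real.exp (κ + max am (-ap) * ρ) *
        (ρ * Real.exp (-κ - max am (-ap) * ρ)) := by
        rw [mul_mul_mul_comm, inv_mul_cancel₀ hρ.ne', ← Real.exp_add, one_mul]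
        ring_nf
        rw [Real.exp_zero]
    _ ≤ ρ⁻¹ * Real.exp (κ + max am (-ap) * ρ) *
        (ε * S * (ℓ * B ^ 2 * Real.exp (κ - min am (-ap) * δ / ε))) := by gcongr
    _ = _ := by
        have hexp : Real.exp (κ - min am (-ap) * δ / ε) =
            Real.exp κ * Real.exp (-(min am (-ap) * δ) / ε) := by
          rw [← Real.exp_add, neg_div, sub_eq_add_neg]
        rw [hexp, two_mul, add_assoc κ, Real.exp_add κ (κ + _)]
        ring

theorem exists_inv_mul_norm_schrodingerInverse_le (hℓ : 0 < ℓ) (hξ : ξ ∈ Ioo (-ℓ) ℓ)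
    (ham : 0 < am) (hap : ap < 0) (hκ : 0 ≤ κ) (ε₀ : ℝ) :
    ∃ C c : ℝ, 0 < C ∧ 0 < c ∧ ∀ ε ∈ Ioo 0 ε₀, ∀ (a : ℝ → ℝ) (K : NNReal)
      (ha : LipschitzOnWith K a (Icc (-ℓ) ℓ)),
      eLpNorm (fun x => a x - stepFun ξ am ap x) 1 (intervalMeasure ℓ) ≤ ENNReal.ofReal (κ * ε) →
      (ε * ‖schrodingerInverse hℓ ε ha.continuousOn‖)⁻¹ ≤ C * Real.exp (-c / ε) := by
  have hd : 0 < min (ξ + ℓ) (ℓ - ξ) := lt_min (by linarith [hξ.1]) (sub_pos.2 hξ.2)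
  obtain ⟨χ, χ', χ'', hχ, hχξ⟩ :=
    exists_isDirichletH2_cutoff hd (min_le_left _ _) (min_le_right _ _)
  set δ := min (ξ + ℓ) (ℓ - ξ) / 2
  have hδ0 : 0 < δ := half_pos hd
  have hleft : δ ≤ ξ + ℓ := (half_le_self hd.le).trans (min_le_left _ _)
  have hright : δ ≤ ℓ - ξ := (half_le_self hd.le).trans (min_le_right _ _)
  obtain ⟨B, hB⟩ := isCompact_Icc.exists_bound_of_continuousOn
    (continuousOn_of_absolutelyContinuousOnInterval hℓ hχ.absCont)
  have hB' : ∀ x ∈ Icc (-ℓ) ℓ, ‖χ' x‖ ≤ max 1 B := fun x hx => (hB x hx).trans (le_max_right 1 B)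
  have hε₀ : 0 < max 1 ε₀ := lt_max_of_lt_left one_pos
  have hρ : 0 < δ / max 1 ε₀ := div_pos hδ0 hε₀
  refine ⟨ℓ * max 1 B ^ 2 / (δ / max 1 ε₀) * Real.exp (2 * κ + max am (-ap) * (δ / max 1 ε₀)),
    min am (-ap) * δ, by positivity, mul_pos (lt_min ham (neg_pos.2 hap)) hδ0,
    fun ε hε a K ha hL1 => ?_⟩
  refine inv_mul_norm_schrodingerInverse_le hℓ hε.1 ha ham hap hκ hL1 (by linarith)
    (by linarith) hρ ?_ hχ hB' hχξ
  rw [mul_div_left_comm]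
  exact mul_lt_of_lt_one_right hδ0 ((div_lt_one hε₀).2 (lt_max_of_lt_right hε.2))

end Gap

end DiffusionTransport

end

open DiffusionTransport in
theorem proposition4p1_general
    (ℓ ξ am ap ε₀ C₁ : ℝ) (hξ : ξ ∈ Set.Ioo (-ℓ) ℓ) (ham : 0 < am) (hap : ap < 0)
    (a : ℝ → ℝ → ℝ)
    (hLip : ∀ ε ∈ Set.Ioo 0 ε₀, ∃ K, LipschitzOnWith K (a ε) (Set.Icc (-ℓ) ℓ))
    (hL1 : ∀ ε ∈ Set.Ioo 0 ε₀,
      MeasureTheory.eLpNorm (fun x => a ε x - stepFun ξ am ap x) 1 (intervalMeasure ℓ)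
        ≤ ENNReal.ofReal (C₁ * ε)) :
    (∀ ε ∈ Set.Ioo 0 ε₀,
      IsSelfAdjointOp (schrodingerOp ℓ ε (a ε)) ∧
      (∀ U F V G : L2 ℓ,
        (V =ᵐ[intervalMeasure ℓ] fun x => (liouvilleFactor ℓ ε (a ε) x : ℂ) * U x) →
        (G =ᵐ[intervalMeasure ℓ] fun x => (ε : ℂ) * (liouvilleFactor ℓ ε (a ε) x : ℂ) * F x) →
        (transportOp ℓ ε (a ε) U F ↔ schrodingerOp ℓ ε (a ε) V G)) ∧
      (∀ z ∈ opSpectrum (transportOp ℓ ε (a ε)),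
        IsEigenvalue (transportOp ℓ ε (a ε)) z ∧ z.im = 0 ∧ z.re < 0)) ∧
    ∃ C c : ℝ, 0 < C ∧ 0 < c ∧ ∀ ε ∈ Set.Ioo 0 ε₀, ∃ lam₁ : ℝ,
      IsGreatest {lam : ℝ | IsEigenvalue (transportOp ℓ ε (a ε)) (lam : ℂ)} lam₁ ∧
      -C * Real.exp (-c / ε) ≤ lam₁ ∧ lam₁ < 0 := by
  have hℓ : 0 < ℓ := by linarith [hξ.1, hξ.2]
  choose! K hK using hLip
  refine ⟨fun ε hε => ⟨isSelfAdjointOp_schrodingerOp hℓ hε.1 (hK ε hε),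
    fun U F V G hV hG => transportOp_iff_schrodingerOp hℓ hε.1 (hK ε hε) hV hG, fun z hz => ?_⟩, ?_⟩
  · have heig := isEigenvalue_transportOp_of_mem_opSpectrum hℓ hε.1 (hK ε hε) hz
    exact ⟨heig, im_eq_zero_and_re_neg_of_isEigenvalue_transportOp hℓ hε.1 (hK ε hε) heig⟩
  obtain ⟨C, c, hC, hc, hgap⟩ := exists_inv_mul_norm_schrodingerInverse_le hℓ hξ ham hap
    (le_max_right C₁ 0) ε₀
  refine ⟨C, c, hC, hc, fun ε hε => ?_⟩
  have hfirst := isGreatest_eigenvalue_transportOp hℓ hε.1 (hK ε hε)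
  refine ⟨_, hfirst, ?_, ?_⟩
  · rw [neg_mul, neg_le_neg_iff]
    refine hgap ε hε (a ε) (K ε) (hK ε hε) ((hL1 ε hε).trans (ENNReal.ofReal_le_ofReal ?_))
    exact mul_le_mul_of_nonneg_right (le_max_left C₁ 0) hε.1.le
  · exact (im_eq_zero_and_re_neg_of_isEigenvalue_transportOp hℓ hε.1 (hK ε hε) hfirst.1).2

open DiffusionTransport in
theorem proposition4p1
    (ℓ ξ am ap ε₀ C₀ C₁ : ℝ) (hξ : ξ ∈ Set.Ioo (-ℓ) ℓ) (ham : 0 < am) (hap : ap < 0)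
    (a : ℝ → ℝ → ℝ)
    (hLip : ∀ ε ∈ Set.Ioo 0 ε₀, ∃ K, LipschitzOnWith K (a ε) (Set.Icc (-ℓ) ℓ))
    (hA0 : ∀ ε ∈ Set.Ioo 0 ε₀,
      MeasureTheory.eLpNorm (a ε) ⊤ (intervalMeasure ℓ)
        + ENNReal.ofReal ε * MeasureTheory.eLpNorm (deriv (a ε)) ⊤ (intervalMeasure ℓ)
        ≤ ENNReal.ofReal C₀)
    (hL1 : ∀ ε ∈ Set.Ioo 0 ε₀,
      MeasureTheory.eLpNorm (fun x => a ε x - stepFun ξ am ap x) 1 (intervalMeasure ℓ)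
        ≤ ENNReal.ofReal (C₁ * ε)) :
    (∀ ε ∈ Set.Ioo 0 ε₀,
      IsSelfAdjointOp (schrodingerOp ℓ ε (a ε)) ∧
      (∀ U F V G : L2 ℓ,
        (V =ᵐ[intervalMeasure ℓ] fun x => (liouvilleFactor ℓ ε (a ε) x : ℂ) * U x) →
        (G =ᵐ[intervalMeasure ℓ] fun x => (ε : ℂ) * (liouvilleFactor ℓ ε (a ε) x : ℂ) * F x) →
        (transportOp ℓ ε (a ε) U F ↔ schrodingerOp ℓ ε (a ε) V G)) ∧
      (∀ z ∈ opSpectrum (transportOp ℓ ε (a ε)),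
        IsEigenvalue (transportOp ℓ ε (a ε)) z ∧ z.im = 0 ∧ z.re < 0)) ∧
    ∃ C c : ℝ, 0 < C ∧ 0 < c ∧ ∀ ε ∈ Set.Ioo 0 ε₀, ∃ lam₁ : ℝ,
      IsGreatest {lam : ℝ | IsEigenvalue (transportOp ℓ ε (a ε)) (lam : ℂ)} lam₁ ∧
      -C * Real.exp (-c / ε) ≤ lam₁ ∧ lam₁ < 0 :=
  proposition4p1_general ℓ ξ am ap ε₀ C₁ hξ ham hap a hLip hL1
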